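/- **Setting.** Let $(Y,\mathbf X,\mathbf Z)\sim P$ with $Y$ a scalar outcome, $\mathbf X\in\mathbb R^d$ a covariate and $\mathbf Z$ an auxiliary variable; let $\widehat q(\cdot)$ be a fixed measurable prediction rule, so that $\widehat q=\widehat q(\mathbf Z)\in\mathbb R^d$ predicts $\mathbf X$; and let $\boldsymbol\psi(y,\mathbf x;\boldsymbol\theta)\in\mathbb R^q$ be a given estimating function, measurable in $(y,\mathbf x)$. Let $(y_i,\mathbf x_i,\mathbf z_i)$, $i\ge1$, be i.i.d. from $P$; for $i\le n$ all of $(y_i,\mathbf x_i,\mathbf z_i)$ is observed (labeled data), for $n<i\le n+N$ only $(y_i,\mathbf z_i)$. Let $N=N(n)\to\infty$ and $n/N\to\rho\in[0,\infty)$ as $n\to\infty$. For $\boldsymbol\omega\in\mathbb R^q$ put $$\Psi^{\boldsymbol\omega}_{n,N}(\boldsymbol\theta)=\frac1n\sum_{i=1}^n\boldsymbol\psi(y_i,\mathbf x_i;\boldsymbol\theta)+\operatorname{diag}(\boldsymbol\omega)\Big\{-\frac1n\sum_{i=1}^n\boldsymbol\psi(y_i,\widehat q(\mathbf z_i);\boldsymbol\theta)+\frac1N\sum_{i=n+1}^{n+N}\boldsymbol\psi(y_i,\widehat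 q(\mathbf z_i);\boldsymbol\theta)\Big\}.$$ **Assumptions.** Let $\boldsymbol\Theta\subset\mathbb R^q$ be compact and $\boldsymbol\theta_0\in\boldsymbol\Theta$ the unique solution in $\boldsymbol\Theta$ of $\mathbb E\{\boldsymbol\psi(Y,\mathbf X;\boldsymbol\theta)\}=\mathbf 0$. Let each of $g(\boldsymbol\theta)=\boldsymbol\psi(Y,\mathbf X;\boldsymbol\theta)$ and $g(\boldsymbol\theta)=\boldsymbol\psi(Y,\widehat q;\boldsymbol\theta)$ be almost surely continuous in $\boldsymbol\theta\in\boldsymbol\Theta$, with $\sup_{\boldsymbol\theta\in\boldsymbol\Theta}\mathbb E\|g(\boldsymbol\theta)\|^2<\infty$ and with an integrable envelope: $\|g(\boldsymbol\theta)\|\le h$ for all $\boldsymbol\theta\in\boldsymbol\Theta$, almost surely, for some $h$ (a function of the data point) with $\mathbb E h<\infty$. Let $\widehat{\boldsymbol\omega}=\widehat{\boldsymbol\omega}_n$ be random vectors with $\widehat{\boldsymbol\omega}\to\boldsymbol\omega$ in probability, and let $\widehat{\boldsymbol\theta}'=\widehat{\boldsymbol\theta}'(\widehat{\boldsymbol\omega})$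 be random vectors which, with probability tending to one, lie in $\boldsymbol\Theta$ and solve $\Psi^{\widehat{\boldsymbol\omega}}_{n,N}(\boldsymbol\theta)=\mathbf 0$ (in particular, the unique solution in $\boldsymbol\Theta$ when there is one). **Conclusions.** 1. $\widehat{\boldsymbol\theta}'\to\boldsymbol\theta_0$ in probability as $n\to\infty$. 2. Assume in addition that each of the two functions $g$ is almost surely differentiable at $\boldsymbol\theta_0$ and satisfies, almost surely, $\|g(\boldsymbol\theta')-g(\boldsymbol\theta'')\|\le\varphi\,\|\boldsymbol\theta'-\boldsymbol\theta''\|$ for all $\boldsymbol\theta',\boldsymbol\theta''$ in some fixed neighborhood of $\boldsymbol\theta_0$, with $\mathbb E\varphi<\infty$ ($\varphi$ a function of the data point), and that $\mathbb E\{\boldsymbol\psi(Y,\mathbf X;\boldsymbol\theta)\}$ is differentiable at $\boldsymbol\theta_0$ with nonsingular derivative matrix. Then $$\sqrt n\,(\widehat{\boldsymbol\theta}'-\boldsymbol\theta_0)\ \xrightarrow{d}\ \mathcal N(\mathbf 0,\boldsymbol\Sigma'(\boldsymbol\omega)),\qquad \boldsymbol\Sigma'(\boldsymbol\omega)=\mathbf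 A^{-1}\mathbf V'(\boldsymbol\omega)\mathbf A^{-\mathrm T},$$ where $\boldsymbol\Sigma'(\boldsymbol\omega)$ is positive semidefinite, $\mathbf A=\mathbb E[\partial\boldsymbol\psi(Y,\mathbf X;\boldsymbol\theta_0)/\partial\boldsymbol\theta]$, $$\mathbf V'(\boldsymbol\omega)=\mathbf M_1+\operatorname{diag}(\boldsymbol\omega)(\mathbf M_2'+\rho\mathbf M_3')\operatorname{diag}(\boldsymbol\omega)-\{\operatorname{diag}(\boldsymbol\omega)\mathbf M_4'^{\mathrm T}+\mathbf M_4'\operatorname{diag}(\boldsymbol\omega)\},$$ $\mathbf M_1=\operatorname{Var}[\boldsymbol\psi(Y,\mathbf X;\boldsymbol\theta_0)]$, $\mathbf M_2'=\mathbf M_3'=\operatorname{Var}[\boldsymbol\psi(Y,\widehat q;\boldsymbol\theta_0)]$ and $\mathbf M_4'=\operatorname{Cov}[\boldsymbol\psi(Y,\mathbf X;\boldsymbol\theta_0),\boldsymbol\psi(Y,\widehat q;\boldsymbol\theta_0)]$. 3. Under the assumptions of 2, let $\widehat{\boldsymbol\Sigma}'$ be random matrices with $\widehat{\boldsymbol\Sigma}'\to\boldsymbol\Sigma'(\boldsymbol\omega)$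 in probability, let $\alpha\in(0,1)$, let $z_{1-\alpha/2}$ be the $(1-\alpha/2)$-quantile of the standard normal distribution, and let $\mathcal C'_{\alpha,j}=\big(\widehat\theta'_j\pm z_{1-\alpha/2}\sqrt{\widehat\Sigma'_{jj}/n}\big)$. Then for every $j\in\{1,\dots,q\}$ with $\Sigma'_{jj}(\boldsymbol\omega)>0$, the limit $\lim_{n\to\infty}\mathbb P(\theta_{0,j}\in\mathcal C'_{\alpha,j})$ exists and is at least $1-\alpha$. -/

import Mathlib

open MeasureTheory ProbabilityTheory Filter Topology

noncomputable section

namespace PSPA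

/-- `ℝ^k` with the Euclidean norm. -/
abbrev Vec (k : ℕ) : Type := EuclideanSpace ℝ (Fin k)

/-- One draw `(y, x, z)` from the population: a scalar outcome, a `d`-dimensional covariate and an
auxiliary variable from which the covariate is predicted. -/
abbrev Obs (d : ℕ) (Z : Type*) : Type _ := ℝ × Vec d × Z

variable {d q : ℕ} {Z : Type*}

/-- The estimating function at the true covariate: `(y, x, z), θ ↦ ψ(y, x; θ)`. -/
def score (psi : ℝ → Vec d → Vec q → Vec q) : Obs d Z → Vec q → Vec q :=
  fun p θ => psi p.1 p.2.1 θ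

/-- The estimating function at the predicted covariate: `(y, x, z), θ ↦ ψ(y, qhat(z); θ)`. -/
def predScore (psi : ℝ → Vec d → Vec q → Vec q) (qhat : Z → Vec d) :
    Obs d Z → Vec q → Vec q :=
  fun p θ => psi p.1 (qhat p.2.2) θ

/-- `diag(w) v`. -/
def diagMul (w : Fin q → ℝ) (v : Vec q) : Vec q :=
  WithLp.toLp 2 (Matrix.mulVec (Matrix.diagonal w) (WithLp.ofLp v))

/-- The estimating equation with predicted covariates and weights `w`, at the data `D 0, D 1, …`,
of which the first `n` are labeled and the next `N` are unlabeled: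
`n⁻¹ ∑_{i ≤ n} ψ(yᵢ, xᵢ; θ)
  + diag(w) {- n⁻¹ ∑_{i ≤ n} ψ(yᵢ, qhat(zᵢ); θ) + N⁻¹ ∑_{n < i ≤ n + N} ψ(yᵢ, qhat(zᵢ); θ)}`.
The covariates of the unlabeled data do not enter. -/
def estEq (psi : ℝ → Vec d → Vec q → Vec q) (qhat : Z → Vec d) (n N : ℕ) (D : ℕ → Obs d Z)
    (w : Fin q → ℝ) (θ : Vec q) : Vec q :=
  (n : ℝ)⁻¹ • ∑ i ∈ Finset.range n, score psi (D i) θ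
    + diagMul w
      (-((n : ℝ)⁻¹ • ∑ i ∈ Finset.range n, predScore psi qhat (D i) θ)
        + (N : ℝ)⁻¹ • ∑ i ∈ Finset.Ico n (n + N), predScore psi qhat (D i) θ)

/-- Cross-covariance matrix of two random vectors, `Cov[f, g]_{ij} = Cov(f_i, g_j)`. -/
def crossCov {S : Type*} [MeasurableSpace S] (P : Measure S) (f g : S → Vec q) :
    Matrix (Fin q) (Fin q) ℝ :=
  Matrix.of fun i j => covariance (fun p => f p i) (fun p => g p j) P

/-- `E[∂g(·; θ)/∂θ]` at `θ₀`; the entry `(i, j)` is `E[∂g_i/∂θ_j]`. -/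
def meanJacobian {S : Type*} [MeasurableSpace S] (P : Measure S) (g : S → Vec q → Vec q)
    (θ₀ : Vec q) : Matrix (Fin q) (Fin q) ℝ :=
  Matrix.of fun i j => ∫ p, (fderiv ℝ (g p) θ₀ (EuclideanSpace.single j 1)) i ∂P

section Population

variable [MeasurableSpace Z] (P : Measure (Obs d Z)) (psi : ℝ → Vec d → Vec q → Vec q)
  (qhat : Z → Vec d) (θ₀ : Vec q)

/-- `M₁ = Var[ψ(Y, X; θ₀)]`. -/
def M1 : Matrix (Fin q) (Fin q) ℝ :=
  crossCov P (fun p => score psi p θ₀) (fun p => score psi p θ₀)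

/-- `M₂' = Var[ψ(Y, qhat; θ₀)]`, from the labeled data. -/
def M2 : Matrix (Fin q) (Fin q) ℝ :=
  crossCov P (fun p => predScore psi qhat p θ₀) (fun p => predScore psi qhat p θ₀)

/-- `M₃' = Var[ψ(Y, qhat; θ₀)]`, from the unlabeled data. -/
def M3 : Matrix (Fin q) (Fin q) ℝ :=
  crossCov P (fun p => predScore psi qhat p θ₀) (fun p => predScore psi qhat p θ₀)

/-- `M₄' = Cov[ψ(Y, X; θ₀), ψ(Y, qhat; θ₀)]`. -/
def M4 : Matrix (Fin q) (Fin q) ℝ :=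
  crossCov P (fun p => score psi p θ₀) (fun p => predScore psi qhat p θ₀)

/-- `V'(w) = M₁ + diag(w)(M₂' + ρ M₃')diag(w) - (diag(w) M₄'ᵀ + M₄' diag(w))`. -/
def V (ρ : ℝ) (w : Fin q → ℝ) : Matrix (Fin q) (Fin q) ℝ :=
  M1 P psi θ₀
    + Matrix.diagonal w * (M2 P psi qhat θ₀ + ρ • M3 P psi qhat θ₀) * Matrix.diagonal w
    - (Matrix.diagonal w * (M4 P psi qhat θ₀).transpose + M4 P psi qhat θ₀ * Matrix.diagonal w)

/-- `A = E[∂ψ(Y, X; θ₀)/∂θ]`. -/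
def A : Matrix (Fin q) (Fin q) ℝ :=
  meanJacobian P (score psi) θ₀

/-- The asymptotic covariance `Σ'(w) = A⁻¹ V'(w) A⁻ᵀ`. -/
def asympCov (ρ : ℝ) (w : Fin q → ℝ) : Matrix (Fin q) (Fin q) ℝ :=
  (A P psi θ₀)⁻¹ * V P psi qhat θ₀ ρ w * ((A P psi θ₀)⁻¹).transpose

end Population

section Conditions

variable {S : Type*} [MeasurableSpace S]

/-- The parameter space is compact and contains `θ₀`, which is the unique solution in it of
`E[g(θ)] = 0`. -/
structure Identified (P : Measure S) (g : S → Vec q → Vec q) (Θ : Set (Vec q)) (θ₀ : Vec q) :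
    Prop where
  isCompact : IsCompact Θ
  mem : θ₀ ∈ Θ
  solves : ∫ p, g p θ₀ ∂P = 0
  unique : ∀ θ ∈ Θ, ∫ p, g p θ ∂P = 0 → θ = θ₀

/-- Almost surely, `g(·; θ)` is continuous in `θ` on the parameter space. -/
def ContinuousInParam (P : Measure S) (g : S → Vec q → Vec q) (Θ : Set (Vec q)) : Prop :=
  ∀ᵐ p ∂P, ContinuousOn (g p) Θ

/-- Uniformly bounded second moments, and an integrable envelope over the parameter space. -/
structure MomentBounds (P : Measure S) (g : S → Vec q → Vec q) (Θ : Set (Vec q)) : Prop where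
  secondMoment : (⨆ θ ∈ Θ, ∫⁻ p, ‖g p θ‖ₑ ^ 2 ∂P) < ⊤
  envelope : ∃ h : S → ℝ, Integrable h P ∧ ∀ᵐ p ∂P, ∀ θ ∈ Θ, ‖g p θ‖ ≤ h p

/-- Local regularity at `θ₀`: `g` is Lipschitz in `θ` on a neighborhood of `θ₀`, with an integrable
Lipschitz constant, and almost surely differentiable in `θ` at `θ₀`. -/
structure LocallyRegular (P : Measure S) (g : S → Vec q → Vec q) (θ₀ : Vec q) : Prop where
  lipschitz : ∃ U ∈ 𝓝 θ₀, ∃ L : S → ℝ, Integrable L P ∧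
    ∀ᵐ p ∂P, ∀ θ₁ ∈ U, ∀ θ₂ ∈ U, ‖g p θ₁ - g p θ₂‖ ≤ L p * ‖θ₁ - θ₂‖
  differentiable : ∀ᵐ p ∂P, DifferentiableAt ℝ (g p) θ₀

/-- `θ ↦ E[g(θ)]` is differentiable at `θ₀` with a nonsingular derivative matrix. -/
def NonsingularMeanDeriv (P : Measure S) (g : S → Vec q → Vec q) (θ₀ : Vec q) : Prop :=
  DifferentiableAt ℝ (fun θ => ∫ p, g p θ ∂P) θ₀ ∧
    (fderiv ℝ (fun θ => ∫ p, g p θ ∂P) θ₀).det ≠ 0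

end Conditions

/-- The quantile function of the standard normal distribution (used at levels in `(0, 1)`). -/
def normalQuantile (p : ℝ) : ℝ :=
  sInf {x : ℝ | p ≤ cdf (gaussianReal 0 1) x}

/-- The Wald interval `estimate ± z_{1 - α/2} √(variance / n)`. -/
def waldInterval (α : ℝ) (n : ℕ) (estimate variance : ℝ) : Set ℝ :=
  Set.Ioo (estimate - normalQuantile (1 - α / 2) * Real.sqrt (variance / n))
    (estimate + normalQuantile (1 - α / 2) * Real.sqrt (variance / n))

end PSPA

end

/-! The estimating equation is a labeled score average plus `diag(what)` times a contrast of two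
averages of the predicted score. The contrast has mean zero at every parameter, so the weights
affect neither the limiting equation nor its derivative `A`; they only reshape the variance.

Everything uniform rests on one law of large numbers on a compact index set `K`, namely the strong
law in the Banach space `C(K, E)` (`ae_tendstoUniformly_average`,
`ae_tendstoUniformly_average_Ico`). With `K = Θ` it gives consistency through compactness and
uniqueness of the zero (`tendsto_of_estimating_zero`). With `K = [0, r] × unit ball` it is applied
to the difference quotients of the scores at `θ₀`. These extend continuously to step zero by
differentiability and are dominated by the Lipschitz constant, so no differentiability is needed
away from `θ₀`. The uniform limit linearizes the equation at the random point `θhat`, with an error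
small relative to the size of the two averages at `θ₀` (`tendsto_linearization_error`). Replacing
`what` by `w` costs only `(what - w)` times the contrast at `θ₀`, which is also of smaller order.

Hence `√n (θhat - θ₀)` is asymptotically `-A⁻¹` times `√n` times the equation at `θ₀` with weights
`w`. This is a sum of two independent block averages, whose characteristic functions multiply; the
unlabeled block enters with the factor `√(n/N) → √ρ` (`tendstoInDistribution_two_sample_crossCov`).
Bilinearity of covariance identifies the limit variance (`asympCov_eq`). Arguments in probability
pass to almost sure ones along subsequences by `tendstoInMeasure_of_subseq`. Coverage follows from
Slutsky and the portmanteau theorem, positivity of the variance making the boundary event null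
(`exists_tendsto_coverage`). -/

noncomputable section

namespace PSPA

/-! ### Uniform law of large numbers over a compact index set -/

section UniformLaw

variable {S K E : Type*} [MeasurableSpace S] [MetricSpace K] [CompactSpace K]
  [NormedAddCommGroup E] [MeasurableSpace E] [BorelSpace E] [SecondCountableTopology E]

/-- A random continuous function on a compact space is measurable as soon as its values are. -/
lemma measurable_continuousMap_of_eval [MeasurableSpace C(K, E)] [BorelSpace C(K, E)]
    {F : S → C(K, E)} (hF : ∀ k, Measurable fun p => F p k) : Measurable F := by
  obtain ⟨T, hTc, hTd⟩ := TopologicalSpace.exists_countable_dense K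
  have hdist : ∀ f : C(K, E), Measurable fun p => dist (F p) f := by
    intro f
    refine measurable_of_Iic fun r => ?_
    rcases lt_or_ge r 0 with hr | hr
    · convert MeasurableSet.empty
      ext p
      simpa using hr.trans_le dist_nonneg
    -- By continuity a sup-distance bound need only be tested on the countable dense set `T`.
    · have : (fun p => dist (F p) f) ⁻¹' Set.Iic r = ⋂ k ∈ T, {p | dist (F p k) (f k) ≤ r} := by
        ext p
        simp only [Set.mem_preimage, Set.mem_Iic, Set.mem_iInter, Set.mem_ofPred_eq,
          ContinuousMap.dist_le hr]
        refine ⟨fun h k _ => h k, fun h k => ?_⟩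
        have hcl : IsClosed {k | dist (F p k) (f k) ≤ r} :=
          isClosed_le (by fun_prop) continuous_const
        have := hcl.closure_subset_iff.2 (fun k hk => h k hk)
        exact this (hTd k)
      rw [this]
      exact MeasurableSet.biInter hTc fun k _ =>
        measurableSet_le ((hF k).dist measurable_const) measurable_const
  have hbasis : TopologicalSpace.IsTopologicalBasis
      {B : Set C(K, E) | ∃ f r, B = Metric.ball f r} := by
    refine TopologicalSpace.isTopologicalBasis_of_isOpen_of_nhds ?_ fun f U hf hU => ?_
    · rintro _ ⟨f, r, rfl⟩
      exact Metric.isOpen_ball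
    · obtain ⟨r, hr, hrU⟩ := Metric.isOpen_iff.1 hU f hf
      exact ⟨_, ⟨f, r, rfl⟩, Metric.mem_ball_self hr, hrU⟩
  have hb := hbasis.borel_eq_generateFrom
  rw [BorelSpace.measurable_eq (α := C(K, E)), hb]
  refine measurable_generateFrom ?_
  rintro _ ⟨f, r, rfl⟩
  exact measurableSet_lt (hdist f) measurable_const

/-- Continuity holds only almost surely and each evaluation is only a.e. measurable. Off a single
measurable null set the paths are continuous and agree with measurable versions on a countable dense
set, which determines them; on the null set the path is reset to zero. -/
lemma aemeasurable_mkD [MeasurableSpace C(K, E)] [BorelSpace C(K, E)] {P : Measure S}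
    {f : S → K → E} (hf : ∀ k, AEMeasurable (fun p => f p k) P)
    (hc : ∀ᵐ p ∂P, Continuous (f p)) : AEMeasurable (fun p => ContinuousMap.mkD (f p) 0) P := by
  obtain ⟨T, hTc, hTd⟩ := TopologicalSpace.exists_countable_dense K
  have hgood : ∀ᵐ p ∂P, Continuous (f p) ∧ ∀ k ∈ T, f p k = (hf k).mk _ p := by
    filter_upwards [hc, (ae_ball_iff hTc).2 fun k _ => (hf k).ae_eq_mk] with p h1 h2
      using ⟨h1, h2⟩
  obtain ⟨B, hBsub, hBm, hB0⟩ := exists_measurable_superset_of_null hgood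
  classical
  refine ⟨fun p => if p ∈ B then 0 else ContinuousMap.mkD (f p) 0, ?_, ?_⟩
  · refine measurable_continuousMap_of_eval fun k => ?_
    obtain ⟨u, huT, hu⟩ := mem_closure_iff_seq_limit.1 (hTd k)
    refine measurable_of_tendsto_metrizable
      (f := fun n p => if p ∈ B then 0 else (hf (u n)).mk _ p) (fun n => ?_) ?_
    · exact Measurable.ite hBm measurable_const (hf (u n)).measurable_mk
    · rw [tendsto_pi_nhds]
      intro p
      by_cases hp : p ∈ B
      · simp [hp]
      · obtain ⟨h1, h2⟩ : Continuous (f p) ∧ ∀ k ∈ T, f p k = (hf k).mk _ p := by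
          by_contra h
          exact hp (hBsub h)
        simp only [hp, if_false, ContinuousMap.mkD_apply_of_continuous h1]
        refine ((h1.tendsto k).comp hu).congr fun n => ?_
        exact h2 _ (huT n)
  · filter_upwards [measure_eq_zero_iff_ae_notMem.1 hB0] with p hp
    simp [hp]

variable [NormedSpace ℝ E] [CompleteSpace E] {Ω : Type*} [MeasurableSpace Ω] {P : Measure S}
  {μ : Measure Ω} {D : ℕ → Ω → S}

/-- Uniform strong law of large numbers over a compact index set. -/
theorem ae_tendstoUniformly_average (hlaw : ∀ i, HasLaw (D i) P μ) (hindep : iIndepFun D μ)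
    {f : S → K → E} (hf : ∀ k, AEMeasurable (fun p => f p k) P)
    (hc : ∀ᵐ p ∂P, Continuous (f p)) {h : S → ℝ} (hh : Integrable h P)
    (hb : ∀ᵐ p ∂P, ∀ k, ‖f p k‖ ≤ h p) :
    Continuous (fun k => ∫ p, f p k ∂P) ∧
    ∀ᵐ s ∂μ, TendstoUniformly
      (fun (n : ℕ) k => (n : ℝ)⁻¹ • ∑ i ∈ Finset.range n, f (D i s) k)
      (fun k => ∫ p, f p k ∂P) atTop := by
  let _ : MeasurableSpace C(K, E) := borel _
  have : BorelSpace C(K, E) := ⟨rfl⟩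
  set F : S → C(K, E) := fun p => ContinuousMap.mkD (f p) 0 with hFdef
  have hFm : AEMeasurable F P := aemeasurable_mkD hf hc
  have hFi : Integrable F P := ⟨hFm.aestronglyMeasurable,
    ContinuousMap.hasFiniteIntegral_mkD_of_bound f 0 hc h hh.2 hb⟩
  have hFeval : ∀ k, (∫ p, F p ∂P) k = ∫ p, f p k ∂P := by
    intro k
    rw [← ContinuousMap.evalCLM_apply ℝ k (∫ p, F p ∂P),
      ← ContinuousLinearMap.integral_comp_comm _ hFi]
    refine integral_congr_ae ?_
    filter_upwards [hc] with p hp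
    simp [hFdef, ContinuousMap.mkD_apply_of_continuous hp]
  refine ⟨by simpa only [← hFeval] using (∫ p, F p ∂P).continuous, ?_⟩
  have hFm' : ∀ i, AEMeasurable F (μ.map (D i)) := fun i => by rw [(hlaw i).map_eq]; exact hFm
  have hid : ∀ i, IdentDistrib (D i) (D 0) μ μ := fun i =>
    ⟨(hlaw i).aemeasurable, (hlaw 0).aemeasurable, by rw [(hlaw i).map_eq, (hlaw 0).map_eq]⟩
  have hFi0 : Integrable F (μ.map (D 0)) := by rw [(hlaw 0).map_eq]; exact hFi
  have hslln := strong_law_ae (μ := μ) (fun i => F ∘ D i)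
    (hFi0.comp_aemeasurable (hlaw 0).aemeasurable)
    (fun i j hij => (hindep.comp₀ (fun _ => F) (fun i => (hlaw i).aemeasurable) hFm').indepFun hij)
    (fun i => (hid i).comp_of_aemeasurable (hFm' i))
  have hmean : ∫ s, (F ∘ D 0) s ∂μ = ∫ p, F p ∂P :=
    (hlaw 0).integral_comp hFm.aestronglyMeasurable
  have hcont : ∀ᵐ s ∂μ, ∀ i, Continuous (f (D i s)) := by
    refine ae_all_iff.2 fun i => ?_
    have : ∀ᵐ p ∂(μ.map (D i)), Continuous (f p) := by rw [(hlaw i).map_eq]; exact hc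
    exact ae_of_ae_map (hlaw i).aemeasurable this
  filter_upwards [hslln, hcont] with s hs hcs
  rw [hmean, ContinuousMap.tendsto_iff_tendstoUniformly] at hs
  convert hs using 2 with n k
  · ext k
    simp [hFdef, ContinuousMap.mkD_apply_of_continuous (hcs _)]
  · exact (hFeval _).symm

/-- Uniform strong law of large numbers for the unlabeled block `n ≤ i < n + N n`. -/
theorem ae_tendstoUniformly_average_Ico (hlaw : ∀ i, HasLaw (D i) P μ) (hindep : iIndepFun D μ)
    {N : ℕ → ℕ} (hN : Tendsto N atTop atTop) {ρ : ℝ}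
    (hρ : Tendsto (fun n : ℕ => (n : ℝ) / (N n : ℝ)) atTop (𝓝 ρ))
    {f : S → K → E} (hf : ∀ k, AEMeasurable (fun p => f p k) P)
    (hc : ∀ᵐ p ∂P, Continuous (f p)) {h : S → ℝ} (hh : Integrable h P)
    (hb : ∀ᵐ p ∂P, ∀ k, ‖f p k‖ ≤ h p) :
    ∀ᵐ s ∂μ, TendstoUniformly
      (fun (n : ℕ) k => (N n : ℝ)⁻¹ • ∑ i ∈ Finset.Ico n (n + N n), f (D i s) k)
      (fun k => ∫ p, f p k ∂P) atTop := by
  obtain ⟨hcont, hae⟩ := ae_tendstoUniformly_average hlaw hindep hf hc hh hb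
  have hcs : ∀ᵐ s ∂μ, ∀ i, Continuous (f (D i s)) := by
    refine ae_all_iff.2 fun i => ?_
    have : ∀ᵐ p ∂(μ.map (D i)), Continuous (f p) := by rw [(hlaw i).map_eq]; exact hc
    exact ae_of_ae_map (hlaw i).aemeasurable this
  filter_upwards [hae, hcs] with s hs hcs
  let avg : ℕ → C(K, E) := fun n =>
    ⟨fun k => (n : ℝ)⁻¹ • ∑ i ∈ Finset.range n, f (D i s) k,
      (continuous_finsetSum _ fun i _ => hcs i).const_smul _⟩
  let m : C(K, E) := ⟨_, hcont⟩
  have havg : Tendsto avg atTop (𝓝 m) := ContinuousMap.tendsto_iff_tendstoUniformly.2 hs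
  have hsum : Tendsto (fun n => n + N n) atTop atTop :=
    tendsto_atTop_mono (fun n => Nat.le_add_left (N n) n) hN
  -- The unlabeled average is this combination of the averages over the first `n + N n` and the
  -- first `n` data, so it inherits their almost sure limit.
  have key : Tendsto (fun n : ℕ => ((n : ℝ) / N n + 1) • avg (n + N n) - ((n : ℝ) / N n) • avg n) atTop
      (𝓝 ((ρ + 1) • m - ρ • m)) :=
    ((hρ.add_const 1).smul (havg.comp hsum)).sub (hρ.smul havg)
  have hm : (ρ + 1) • m - ρ • m = m := by rw [add_smul, one_smul]; abel
  rw [hm, ContinuousMap.tendsto_iff_tendstoUniformly] at key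
  intro U hU
  filter_upwards [key U hU, hN.eventually_gt_atTop 0, eventually_gt_atTop 0] with n hU hn hn0 k
  have hNn : (N n : ℝ) ≠ 0 := by exact_mod_cast hn.ne'
  have hn' : (n : ℝ) ≠ 0 := by exact_mod_cast hn0.ne'
  have hnN : (n : ℝ) + N n ≠ 0 := by positivity
  have e1 : ((n : ℝ) / N n + 1) * (n + N n : ℝ)⁻¹ = (N n : ℝ)⁻¹ := by field_simp
  have e2 : ((n : ℝ) / N n) * (n : ℝ)⁻¹ = (N n : ℝ)⁻¹ := by field_simp
  refine (Eq.subst (motive := fun v => (_, v) ∈ U) ?_ (hU k))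
  simp only [avg, ContinuousMap.sub_apply, ContinuousMap.smul_apply, ContinuousMap.coe_mk,
    Nat.cast_add, smul_smul, e1, e2, ← smul_sub, Finset.sum_Ico_eq_sub _ (Nat.le_add_right n (N n))]

end UniformLaw

/-! ### Central limit theorem for two independent blocks -/

section CentralLimit

variable {S Ω : Type*} [MeasurableSpace S] [MeasurableSpace Ω] {P : Measure S}
  {μ : Measure Ω} {D : ℕ → Ω → S}

/-- The characteristic function of an i.i.d. sum is a power of a common one, so only the number of
summands matters. -/
lemma identDistrib_sum_Ico [IsProbabilityMeasure μ]
    (hlaw : ∀ i, HasLaw (D i) P μ) (hindep : iIndepFun D μ)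
    {y : S → ℝ} (hy : AEMeasurable y P) (n m : ℕ) :
    IdentDistrib (fun s => ∑ i ∈ Finset.Ico n (n + m), y (D i s))
      (fun s => ∑ i ∈ Finset.range m, y (D i s)) μ μ := by
  have hy' : ∀ i, AEMeasurable y (μ.map (D i)) := fun i => by rw [(hlaw i).map_eq]; exact hy
  have hYm : ∀ i, AEMeasurable (fun s => y (D i s)) μ := fun i =>
    (hy' i).comp_aemeasurable (hlaw i).aemeasurable
  have hYi : iIndepFun (fun i s => y (D i s)) μ :=
    hindep.comp₀ (fun _ => y) (fun i => (hlaw i).aemeasurable) hy'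
  have hYl : ∀ i, μ.map (fun s => y (D i s)) = P.map y := fun i => by
    rw [← (hlaw i).map_eq, AEMeasurable.map_map_of_aemeasurable (hy' i) (hlaw i).aemeasurable]
    rfl
  refine ⟨Finset.aemeasurable_fun_sum _ fun i _ => hYm i,
    Finset.aemeasurable_fun_sum _ fun i _ => hYm i, ?_⟩
  refine Measure.ext_of_charFun ?_
  ext t
  rw [(hYi.restrict _).charFun_map_fun_finsetSum_eq_prod (fun i _ => hYm i),
    (hYi.restrict _).charFun_map_fun_finsetSum_eq_prod (fun i _ => hYm i)]
  simp [hYl]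

/-- The pairs `(x, y)` at the data form a single independent family, and the two sums are functions
of its restrictions to disjoint index blocks. -/
lemma indepFun_block_sums (hlaw : ∀ i, HasLaw (D i) P μ) (hindep : iIndepFun D μ)
    {x y : S → ℝ} (hx : AEMeasurable x P) (hy : AEMeasurable y P) (n m : ℕ) :
    IndepFun (fun s => ∑ i ∈ Finset.range n, x (D i s))
      (fun s => ∑ i ∈ Finset.Ico n (n + m), y (D i s)) μ := by
  have hm : ∀ {y : S → ℝ}, AEMeasurable y P → ∀ i, AEMeasurable y (μ.map (D i)) :=
    fun hy i => by rw [(hlaw i).map_eq]; exact hy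
  have hxy : ∀ i, AEMeasurable (fun p => (x p, y p)) (μ.map (D i)) := fun i =>
    (hm hx i).prodMk (hm hy i)
  have hYi : iIndepFun (fun i s => (x (D i s), y (D i s))) μ :=
    hindep.comp₀ (fun _ p => (x p, y p)) (fun i => (hlaw i).aemeasurable) hxy
  have hd : Disjoint (Finset.range n) (Finset.Ico n (n + m)) := by
    rw [Finset.disjoint_left]
    intro i hi hi'
    simp only [Finset.mem_range, Finset.mem_Ico] at hi hi'
    omega
  have := hYi.indepFun_finset₀ _ _ hd fun i => (hxy i).comp_aemeasurable (hlaw i).aemeasurable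
  have h2 := this.comp (φ := fun v : Finset.range n → ℝ × ℝ => ∑ i, (v i).1)
    (ψ := fun v : Finset.Ico n (n + m) → ℝ × ℝ => ∑ i, (v i).2) (by fun_prop) (by fun_prop)
  convert h2 using 1
  · ext s
    exact (Finset.sum_coe_sort (Finset.range n) fun i => x (D i s)).symm
  · ext s
    exact (Finset.sum_coe_sort (Finset.Ico n (n + m)) fun i => y (D i s)).symm

lemma tendsto_charFun_scaled_centered_sum [IsProbabilityMeasure μ]
    (hlaw : ∀ i, HasLaw (D i) P μ) (hindep : iIndepFun D μ)
    {x : S → ℝ} (hx : MemLp x 2 P) :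
    TendstoInDistribution
      (fun (n : ℕ) s => (√n)⁻¹ * (∑ i ∈ Finset.range n, x (D i s) - n * ∫ p, x p ∂P)) atTop
      id (fun _ => μ) (gaussianReal 0 Var[x; P].toNNReal) := by
  have hm : ∀ i, AEMeasurable x (μ.map (D i)) := fun i => by
    rw [(hlaw i).map_eq]; exact hx.aestronglyMeasurable.aemeasurable
  have hid : ∀ i, IdentDistrib (D i) (D 0) μ μ := fun i =>
    ⟨(hlaw i).aemeasurable, (hlaw 0).aemeasurable, by rw [(hlaw i).map_eq, (hlaw 0).map_eq]⟩
  have hmean : ∫ s, (x ∘ D 0) s ∂μ = ∫ p, x p ∂P := (hlaw 0).integral_comp hx.1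
  have hvar : Var[x ∘ D 0; μ] = Var[x; P] := by
    rw [← (hlaw 0).map_eq, variance_map (hm 0) (hlaw 0).aemeasurable]
  have hx0 : MemLp (x ∘ D 0) 2 μ := by
    refine (memLp_map_measure_iff ?_ (hlaw 0).aemeasurable).1 ?_ <;> rw [(hlaw 0).map_eq]
    exacts [hx.1, hx]
  have := tendstoInDistribution_inv_sqrt_mul_sum_sub (P := μ) (X := fun i => x ∘ D i)
    (Y := id) (P' := gaussianReal 0 Var[x ∘ D 0; μ].toNNReal) HasLaw.id hx0
    (hindep.comp₀ (fun _ => x) (fun i => (hlaw i).aemeasurable) hm)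
    (fun i => (hid i).comp_of_aemeasurable (hm i))
  simp only [hmean] at this
  rw! [hvar] at this
  exact this

/-- Each block obeys the scalar central limit theorem in its own normalization, the second being
rescaled by `√(n/N)`; independence multiplies the characteristic functions. Evaluation at `1`
suffices, since other arguments are absorbed into `x` and `y`. -/
lemma tendsto_charFun_two_sample [IsProbabilityMeasure P] [IsProbabilityMeasure μ]
    (hlaw : ∀ i, HasLaw (D i) P μ) (hindep : iIndepFun D μ)
    {N : ℕ → ℕ} (hN : Tendsto N atTop atTop) {ρ : ℝ}
    (hρ : Tendsto (fun n : ℕ => (n : ℝ) / (N n : ℝ)) atTop (𝓝 ρ))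
    {x y : S → ℝ} (hx : MemLp x 2 P) (hy : MemLp y 2 P) (h0 : ∫ p, x p ∂P + ∫ p, y p ∂P = 0) :
    Tendsto (fun n : ℕ => charFun (μ.map fun s =>
      √n * ((n : ℝ)⁻¹ * ∑ i ∈ Finset.range n, x (D i s) +
        (N n : ℝ)⁻¹ * ∑ i ∈ Finset.Ico n (n + N n), y (D i s))) 1) atTop
      (𝓝 (Complex.exp (-((Var[x; P] + ρ * Var[y; P] : ℝ) : ℂ) / 2))) := by
  have hρ0 : 0 ≤ ρ := ge_of_tendsto' hρ fun n => by positivity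
  have hAEx := hx.1.aemeasurable
  have hAEy := hy.1.aemeasurable
  have hm : ∀ {y : S → ℝ}, AEMeasurable y P → ∀ i, AEMeasurable (fun s => y (D i s)) μ := by
    intro y hy i
    exact AEMeasurable.comp_aemeasurable (by rw [(hlaw i).map_eq]; exact hy) (hlaw i).aemeasurable
  have hX := tendsto_charFun_scaled_centered_sum hlaw hindep hx
  have hY := (tendsto_charFun_scaled_centered_sum hlaw hindep hy)
  have hYN : TendstoInDistribution
      (fun (n : ℕ) s => (√(N n))⁻¹ * (∑ i ∈ Finset.range (N n), y (D i s) - N n * ∫ p, y p ∂P))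
      atTop id (fun _ => μ) (gaussianReal 0 Var[y; P].toNNReal) :=
    ⟨fun n => hY.forall_aemeasurable (N n), hY.aemeasurable_limit, hY.tendsto.comp hN⟩
  have hc : TendstoInMeasure μ (fun (n : ℕ) (_ : Ω) => √((n : ℝ) / N n)) atTop (fun _ => √ρ) :=
    tendstoInMeasure_of_tendsto_ae (fun n => by fun_prop) (ae_of_all _ fun _ => hρ.sqrt)
  have hYc := hYN.continuous_comp_prodMk_of_tendstoInMeasure_const (g := fun p : ℝ × ℝ => p.2 * p.1)
    (by fun_prop) hc (fun n => by fun_prop)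
  have hXch := ProbabilityMeasure.tendsto_iff_tendsto_charFun.1 hX.tendsto 1
  have hYch := ProbabilityMeasure.tendsto_iff_tendsto_charFun.1 hYc.tendsto 1
  simp only [ProbabilityMeasure.coe_mk, Measure.map_id, id] at hXch hYch
  rw [gaussianReal_map_const_mul] at hYch
  rw [charFun_gaussianReal] at hXch hYch
  have hprod := hXch.mul hYch
  rw [← Complex.exp_add] at hprod
  have harg : (1 : ℝ) * (0 : ℝ) * Complex.I - (Var[x; P].toNNReal : ℝ) * (1 : ℝ) ^ 2 / 2 +
      ((1 : ℝ) * (√ρ * 0 : ℝ) * Complex.I -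
        ((NNReal.mk (√ρ ^ 2) (sq_nonneg _) * Var[y; P].toNNReal : NNReal) : ℝ) * (1 : ℝ) ^ 2 / 2) =
      -((Var[x; P] + ρ * Var[y; P] : ℝ) : ℂ) / 2 := by
    push_cast
    rw [Real.coe_toNNReal _ (variance_nonneg _ _), Real.coe_toNNReal _ (variance_nonneg _ _)]
    rw [← Complex.ofReal_pow, Real.sq_sqrt hρ0]
    ring
  rw [harg] at hprod
  refine hprod.congr' ?_
  filter_upwards [hN.eventually_gt_atTop 0, eventually_gt_atTop 0] with n hNn hn
  have hNn' : (0 : ℝ) < N n := by exact_mod_cast hNn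
  have hn' : (0 : ℝ) < n := by exact_mod_cast hn
  have hNs : √(N n : ℝ) ^ 2 = N n := Real.sq_sqrt hNn'.le
  have hns : √(n : ℝ) ^ 2 = n := Real.sq_sqrt hn'.le
  have hNs0 : 0 < √(N n : ℝ) := Real.sqrt_pos.2 hNn'
  have hns0 : 0 < √(n : ℝ) := Real.sqrt_pos.2 hn'
  have hsplit : (fun s => √n * ((n : ℝ)⁻¹ * ∑ i ∈ Finset.range n, x (D i s) +
        (N n : ℝ)⁻¹ * ∑ i ∈ Finset.Ico n (n + N n), y (D i s))) = fun s =>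
      (√n)⁻¹ * (∑ i ∈ Finset.range n, x (D i s) - n * ∫ p, x p ∂P) +
      √((n : ℝ) / N n) * ((√(N n))⁻¹ *
        (∑ i ∈ Finset.Ico n (n + N n), y (D i s) - N n * ∫ p, y p ∂P)) := by
    ext s
    -- The two means are opposite, so the centering terms cancel in the sum.
    rw [Real.sqrt_div hn'.le, eq_neg_of_add_eq_zero_left h0]
    have key : ∀ a b X Y m : ℝ, 0 < a → 0 < b → a * ((a ^ 2)⁻¹ * X + (b ^ 2)⁻¹ * Y) =
        a⁻¹ * (X - a ^ 2 * -m) + a / b * (b⁻¹ * (Y - b ^ 2 * m)) := by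
      intro a b X Y m ha hb
      field_simp
      ring
    simpa only [hns, hNs] using key (√n) (√(N n)) (∑ i ∈ Finset.range n, x (D i s))
      (∑ i ∈ Finset.Ico n (n + N n), y (D i s)) (∫ p, y p ∂P) hns0 hNs0
  rw [hsplit]
  have hind := (indepFun_block_sums hlaw hindep hAEx hAEy n (N n)).comp
    (φ := fun v => (√n)⁻¹ * (v - n * ∫ p, x p ∂P))
    (ψ := fun v => √((n : ℝ) / N n) * ((√(N n))⁻¹ * (v - N n * ∫ p, y p ∂P)))
    (by fun_prop) (by fun_prop)
  have hmx : AEMeasurable (fun s => ∑ i ∈ Finset.range n, x (D i s)) μ :=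
    Finset.aemeasurable_fun_sum _ fun i _ => hm hAEx i
  have hmy : AEMeasurable (fun s => ∑ i ∈ Finset.Ico n (n + N n), y (D i s)) μ :=
    Finset.aemeasurable_fun_sum _ fun i _ => hm hAEy i
  have e1 := IndepFun.charFun_map_fun_add_eq_mul (((hmx.sub_const _).const_mul _))
    (((hmy.sub_const _).const_mul _).const_mul _) hind
  rw [e1, Pi.mul_apply]
  congr 2
  -- The unlabeled block moves with `n`; it is replaced by an initial block with the same law, for
  -- which the limit is known.
  have := ((identDistrib_sum_Ico hlaw hindep hAEy n (N n)).comp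
    (u := fun v => √((n : ℝ) / N n) * ((√(N n))⁻¹ * (v - N n * ∫ p, y p ∂P)))
    (by fun_prop)).map_eq
  simp only [Function.comp_def] at this
  rw [this]

/-- Central limit theorem for the sum of the averages over the labeled and the unlabeled block. -/
theorem tendstoInDistribution_two_sample [IsProbabilityMeasure P] [IsProbabilityMeasure μ] {q : ℕ}
    (hlaw : ∀ i, HasLaw (D i) P μ) (hindep : iIndepFun D μ)
    {N : ℕ → ℕ} (hN : Tendsto N atTop atTop) {ρ : ℝ}
    (hρ : Tendsto (fun n : ℕ => (n : ℝ) / (N n : ℝ)) atTop (𝓝 ρ))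
    {ξ η : S → Vec q} (hξ : MemLp ξ 2 P) (hη : MemLp η 2 P)
    (h0 : ∫ p, ξ p ∂P + ∫ p, η p ∂P = 0) {Sig : Matrix (Fin q) (Fin q) ℝ} (hSig : Sig.PosSemidef)
    (hvar : ∀ t : Vec q, t ⬝ᵥ Sig.mulVec t =
      Var[fun p => inner ℝ (ξ p) t; P] + ρ * Var[fun p => inner ℝ (η p) t; P]) :
    TendstoInDistribution (fun (n : ℕ) s => √n • ((n : ℝ)⁻¹ • ∑ i ∈ Finset.range n, ξ (D i s) +
        (N n : ℝ)⁻¹ • ∑ i ∈ Finset.Ico n (n + N n), η (D i s))) atTop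
      id (fun _ => μ) (multivariateGaussian 0 Sig) := by
  have hm : ∀ {y : S → Vec q}, AEMeasurable y P → ∀ i, AEMeasurable (fun s => y (D i s)) μ := by
    intro y hy i
    exact AEMeasurable.comp_aemeasurable (by rw [(hlaw i).map_eq]; exact hy) (hlaw i).aemeasurable
  have hmeas : ∀ n : ℕ, AEMeasurable (fun s => √n • ((n : ℝ)⁻¹ • ∑ i ∈ Finset.range n, ξ (D i s) +
        (N n : ℝ)⁻¹ • ∑ i ∈ Finset.Ico n (n + N n), η (D i s))) μ := by
    intro n
    have h1 : AEMeasurable (fun s => ∑ i ∈ Finset.range n, ξ (D i s)) μ :=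
      Finset.aemeasurable_fun_sum _ fun i _ => hm hξ.1.aemeasurable i
    have h2 : AEMeasurable (fun s => ∑ i ∈ Finset.Ico n (n + N n), η (D i s)) μ :=
      Finset.aemeasurable_fun_sum _ fun i _ => hm hη.1.aemeasurable i
    fun_prop
  refine ⟨hmeas, by fun_prop, ProbabilityMeasure.tendsto_iff_tendsto_charFun.2 fun t => ?_⟩
  simp only [ProbabilityMeasure.coe_mk, Measure.map_id]
  rw [charFun_multivariateGaussian hSig, hvar]
  have hint : ∀ {ζ : S → Vec q}, MemLp ζ 2 P → ∫ p, inner ℝ (ζ p) t ∂P =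
      inner ℝ (∫ p, ζ p ∂P) t := fun {ζ} h => by
    simp_rw [real_inner_comm t]
    exact integral_inner (h.integrable (by norm_num)) t
  have key := tendsto_charFun_two_sample hlaw hindep hN hρ (hξ.inner_const t) (hη.inner_const t)
    (by rw [hint hξ, hint hη, ← inner_add_left, h0, inner_zero_left])
  convert key using 2 with n
  · rw [charFun_apply, charFun_apply, integral_map (hmeas n) (by fun_prop),
      integral_map _ (by fun_prop)]
    · congr 1
      ext s
      simp [inner_smul_left, inner_add_left, sum_inner, mul_add]
    · refine ((hmeas n).inner_const (c := t)).congr (ae_of_all _ fun s => ?_)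
      simp [inner_smul_left, inner_add_left, sum_inner, mul_add]
  · congr 1
    simp
    ring

end CentralLimit

/-! ### Difference quotients as a continuous family on a compact space -/

section DifferenceQuotient

variable {q : ℕ}

/-- The difference quotient of `g` at `θ₀`, with step `t` in direction `u`, extended to `t = 0` by
the derivative. -/
def diffQuot (g : Vec q → Vec q) (θ₀ : Vec q) (t : ℝ) (u : Vec q) : Vec q :=
  if t = 0 then fderiv ℝ g θ₀ u else t⁻¹ • (g (θ₀ + t • u) - g θ₀)

/-- Steps of length at most `r` and directions of norm at most one. -/
abbrev StepDir (q : ℕ) (r : ℝ) : Type :=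
  Set.Icc (0 : ℝ) r × Metric.closedBall (0 : Vec q) 1

lemma StepDir.mem_closedBall {r : ℝ} (k : StepDir q r) (θ₀ : Vec q) :
    θ₀ + (k.1 : ℝ) • (k.2 : Vec q) ∈ Metric.closedBall θ₀ r := by
  have h1 := k.1.2.1
  have h2 := k.1.2.2
  have h3 : ‖(k.2 : Vec q)‖ ≤ 1 := mem_closedBall_zero_iff.1 k.2.2
  rw [Metric.mem_closedBall, dist_eq_norm, add_sub_cancel_left, norm_smul, Real.norm_of_nonneg h1]
  nlinarith [norm_nonneg (k.2 : Vec q)]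

lemma smul_diffQuot (g : Vec q → Vec q) (θ₀ : Vec q) (t : ℝ) (u : Vec q) :
    t • diffQuot g θ₀ t u = g (θ₀ + t • u) - g θ₀ := by
  unfold diffQuot
  split_ifs with h
  · simp [h]
  · rw [smul_smul, mul_inv_cancel₀ h, one_smul]

variable {g : Vec q → Vec q} {θ₀ : Vec q} {r L : ℝ}

/-- Only step zero is delicate: Fréchet differentiability makes the quotient close to the derivative
uniformly over directions in the unit ball, and the derivative is continuous in the direction. -/
lemma continuous_diffQuot
    (hL : ∀ θ₁ ∈ Metric.closedBall θ₀ r, ∀ θ₂ ∈ Metric.closedBall θ₀ r,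
      ‖g θ₁ - g θ₂‖ ≤ L * ‖θ₁ - θ₂‖) (hd : DifferentiableAt ℝ g θ₀) :
    Continuous fun k : StepDir q r => diffQuot g θ₀ k.1 k.2 := by
  have hgc : ContinuousOn g (Metric.closedBall θ₀ r) := by
    have : LipschitzOnWith |L|.toNNReal g (Metric.closedBall θ₀ r) := by
      refine LipschitzOnWith.of_dist_le_mul fun x hx y hy => ?_
      rw [dist_eq_norm, dist_eq_norm, Real.coe_toNNReal _ (abs_nonneg L)]
      exact (hL x hx y hy).trans (by gcongr; exact le_abs_self L)
    exact this.continuousOn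
  have hG : Continuous fun k : StepDir q r => g (θ₀ + (k.1 : ℝ) • (k.2 : Vec q)) :=
    hgc.comp_continuous (by fun_prop) fun k => k.mem_closedBall θ₀
  rw [continuous_iff_continuousAt]
  intro k₀
  by_cases h0 : (k₀.1 : ℝ) = 0
  · rw [Metric.continuousAt_iff']
    intro ε hε
    have hlo := hd.hasFDerivAt.isLittleO
    have hlo' := (Asymptotics.isLittleO_iff.1 hlo (half_pos hε))
    obtain ⟨δ, hδ, hδb⟩ := Metric.eventually_nhds_iff.1 hlo'
    have c1 : ContinuousAt (fun k : StepDir q r => (k.1 : ℝ)) k₀ := by fun_prop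
    have c2 : ContinuousAt (fun k : StepDir q r => fderiv ℝ g θ₀ (k.2 : Vec q)) k₀ := by fun_prop
    filter_upwards [Metric.continuousAt_iff'.1 c1 δ hδ, Metric.continuousAt_iff'.1 c2 _ (half_pos hε)]
      with k hk1 hk2
    have h3 : ‖(k.2 : Vec q)‖ ≤ 1 := mem_closedBall_zero_iff.1 k.2.2
    have hk : ‖diffQuot g θ₀ k.1 k.2 - fderiv ℝ g θ₀ (k.2 : Vec q)‖ ≤ ε / 2 := by
      unfold diffQuot
      split_ifs with ht
      · simpa using (half_pos hε).le
      · have htp : 0 < (k.1 : ℝ) := lt_of_le_of_ne k.1.2.1 (Ne.symm ht)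
        have := hδb (y := θ₀ + (k.1 : ℝ) • (k.2 : Vec q)) (by
          rw [dist_eq_norm, add_sub_cancel_left, norm_smul]
          rw [h0, dist_zero_right] at hk1
          nlinarith [norm_nonneg (k.2 : Vec q), norm_nonneg (k.1 : ℝ)])
        rw [add_sub_cancel_left, map_smul, norm_smul, Real.norm_of_nonneg htp.le] at this
        have e : (k.1 : ℝ)⁻¹ • (g (θ₀ + (k.1 : ℝ) • (k.2 : Vec q)) - g θ₀) -
            fderiv ℝ g θ₀ (k.2 : Vec q) = (k.1 : ℝ)⁻¹ • (g (θ₀ + (k.1 : ℝ) • (k.2 : Vec q)) - g θ₀ -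
            (k.1 : ℝ) • fderiv ℝ g θ₀ (k.2 : Vec q)) := by
          rw [smul_sub _ (_ - _), smul_smul, inv_mul_cancel₀ ht, one_smul]
        rw [e, norm_smul, norm_inv, Real.norm_of_nonneg htp.le, inv_mul_le_iff₀ htp]
        refine this.trans ?_
        nlinarith [mul_le_of_le_one_right htp.le h3]
    have e0 : diffQuot g θ₀ k₀.1 k₀.2 = fderiv ℝ g θ₀ (k₀.2 : Vec q) := by simp [diffQuot, h0]
    rw [e0, dist_eq_norm]
    rw [dist_eq_norm] at hk2
    calc _ = ‖(diffQuot g θ₀ k.1 k.2 - fderiv ℝ g θ₀ (k.2 : Vec q)) +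
          (fderiv ℝ g θ₀ (k.2 : Vec q) - fderiv ℝ g θ₀ (k₀.2 : Vec q))‖ := by congr 1; abel
      _ ≤ _ := norm_add_le _ _
      _ < ε / 2 + ε / 2 := by linarith
      _ = ε := by ring
  · have c1 : ContinuousAt (fun k : StepDir q r => (k.1 : ℝ)) k₀ := by fun_prop
    have : ContinuousAt (fun k : StepDir q r =>
        (k.1 : ℝ)⁻¹ • (g (θ₀ + (k.1 : ℝ) • (k.2 : Vec q)) - g θ₀)) k₀ :=
      (c1.inv₀ h0).smul (hG.continuousAt.sub continuousAt_const)
    refine this.congr ?_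
    filter_upwards [c1.eventually_ne h0] with k hk
    simp [diffQuot, hk]

/-- The Lipschitz inequality divided by the step, or, at step zero, its consequence for the operator
norm of the derivative. This provides the envelope for the uniform law. -/
lemma norm_diffQuot_le (hr : 0 < r)
    (hL : ∀ θ₁ ∈ Metric.closedBall θ₀ r, ∀ θ₂ ∈ Metric.closedBall θ₀ r,
      ‖g θ₁ - g θ₂‖ ≤ L * ‖θ₁ - θ₂‖) (k : StepDir q r) :
    ‖diffQuot g θ₀ k.1 k.2‖ ≤ |L| := by
  have h3 : ‖(k.2 : Vec q)‖ ≤ 1 := mem_closedBall_zero_iff.1 k.2.2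
  have hθ : θ₀ ∈ Metric.closedBall θ₀ r := Metric.mem_closedBall_self hr.le
  unfold diffQuot
  split_ifs with ht
  · have hf : ‖fderiv ℝ g θ₀‖ ≤ |L| := by
      refine norm_fderiv_le_of_lip' ℝ (abs_nonneg L) ?_
      filter_upwards [Metric.closedBall_mem_nhds θ₀ hr] with θ hθ'
      exact (hL θ hθ' θ₀ hθ).trans (by gcongr; exact le_abs_self L)
    exact ((fderiv ℝ g θ₀).le_opNorm _).trans (by nlinarith [norm_nonneg (fderiv ℝ g θ₀)])
  · have htp : 0 < (k.1 : ℝ) := lt_of_le_of_ne k.1.2.1 (Ne.symm ht)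
    have := hL _ (k.mem_closedBall θ₀) θ₀ hθ
    rw [add_sub_cancel_left, norm_smul, Real.norm_of_nonneg htp.le] at this
    rw [norm_smul, norm_inv, Real.norm_of_nonneg htp.le, inv_mul_le_iff₀ htp]
    refine this.trans ?_
    calc L * (k.1 * ‖(k.2 : Vec q)‖) ≤ |L| * (k.1 * 1) := by gcongr; exact le_abs_self L
      _ = _ := by ring

end DifferenceQuotient

/-! ### Differentiation under the expectation at `θ₀` -/

section MeanDerivative

variable {q : ℕ} {S : Type*} [MeasurableSpace S] {P : Measure S} {g : S → Vec q → Vec q}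
  {θ₀ : Vec q}

/-- Verifies the hypotheses of the uniform law for difference quotients. All radii below `r₀` are
allowed so that two functions can share a radius. -/
lemma LocallyRegular.exists_diffQuot (hg : LocallyRegular P g θ₀)
    (hm : ∀ θ, AEMeasurable (fun p => g p θ) P) :
    ∃ r₀ > 0, ∃ h : S → ℝ, Integrable h P ∧ ∀ r, 0 < r → r ≤ r₀ →
      (∀ k : StepDir q r, AEMeasurable (fun p => diffQuot (g p) θ₀ k.1 k.2) P) ∧
      (∀ᵐ p ∂P, Continuous fun k : StepDir q r => diffQuot (g p) θ₀ k.1 k.2) ∧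
      ∀ᵐ p ∂P, ∀ k : StepDir q r, ‖diffQuot (g p) θ₀ k.1 k.2‖ ≤ h p := by
  obtain ⟨U, hU, L, hL, hlip⟩ := hg.lipschitz
  obtain ⟨r₀, hr₀, hr₀U⟩ := Metric.nhds_basis_closedBall.mem_iff.1 hU
  refine ⟨r₀, hr₀, fun p => |L p|, hL.abs, fun r hr hrr => ?_⟩
  have hsub : Metric.closedBall θ₀ r ⊆ U := (Metric.closedBall_subset_closedBall hrr).trans hr₀U
  have hc : ∀ᵐ p ∂P, Continuous fun k : StepDir q r => diffQuot (g p) θ₀ k.1 k.2 := by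
    filter_upwards [hlip, hg.differentiable] with p h1 h2
    exact continuous_diffQuot (fun x hx y hy => h1 x (hsub hx) y (hsub hy)) h2
  refine ⟨fun k => ?_, hc, ?_⟩
  · have hpos : ∀ t : ℝ, t ≠ 0 → ∀ u, AEMeasurable (fun p => diffQuot (g p) θ₀ t u) P := by
      intro t ht u
      simp only [diffQuot, ht, if_false]
      have h1 := hm (θ₀ + t • u)
      have h2 := hm θ₀
      fun_prop
    by_cases hk : (k.1 : ℝ) = 0
    -- At step zero, measurability of the derivative comes from that of the quotients at the
    -- positive steps `r / (n + 1)`.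
    · let τ : ℕ → Set.Icc (0 : ℝ) r := fun n => ⟨r / (n + 1), by positivity,
        div_le_self hr.le (by linarith [(Nat.cast_nonneg n : (0 : ℝ) ≤ n)])⟩
      have hτ : Tendsto τ atTop (𝓝 k.1) := by
        rw [tendsto_subtype_rng, hk]
        exact tendsto_const_div_atTop_nhds_zero_nat r |>.comp (tendsto_add_atTop_nat 1) |>.congr
          fun n => by simp [τ]
      refine aemeasurable_of_tendsto_metrizable_ae atTop
        (fun n => hpos (τ n) (by simp only [τ]; positivity) k.2) ?_
      filter_upwards [hc] with p hp
      exact (hp.tendsto k).comp (hτ.prodMk_nhds tendsto_const_nhds)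
    · exact hpos _ hk _
  · filter_upwards [hlip] with p h1 k
    exact norm_diffQuot_le hr (fun x hx y hy => h1 x (hsub hx) y (hsub hy)) k

/-- The derivative is linear in the direction, so the basis directions suffice; these lie in the
unit ball, where the envelope gives integrability. -/
lemma integral_diffQuot_zero {r : ℝ} (hr : 0 ≤ r) {h : S → ℝ} (hh : Integrable h P)
    (hm : ∀ k : StepDir q r, AEMeasurable (fun p => diffQuot (g p) θ₀ k.1 k.2) P)
    (hb : ∀ᵐ p ∂P, ∀ k : StepDir q r, ‖diffQuot (g p) θ₀ k.1 k.2‖ ≤ h p)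
    (u : Vec q) :
    ∫ p, diffQuot (g p) θ₀ 0 u ∂P = Matrix.toEuclideanCLM (𝕜 := ℝ) (meanJacobian P g θ₀) u := by
  have hint : ∀ j : Fin q, Integrable (fun p => fderiv ℝ (g p) θ₀ (EuclideanSpace.single j 1)) P := by
    intro j
    let k : StepDir q r := (⟨0, le_refl _, hr⟩, ⟨EuclideanSpace.single j 1, by simp⟩)
    have hk := hm k
    simp only [diffQuot, k, if_true] at hk
    refine hh.mono' hk.aestronglyMeasurable ?_
    filter_upwards [hb] with p hp
    simpa [diffQuot, k] using hp k
  have hexp : ∀ p, diffQuot (g p) θ₀ 0 u =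
      ∑ j, u j • fderiv ℝ (g p) θ₀ (EuclideanSpace.single j 1) := by
    intro p
    conv_lhs => rw [diffQuot, if_pos rfl, ← (EuclideanSpace.basisFun (Fin q) ℝ).sum_repr u]
    simp
  simp only [hexp]
  rw [integral_finsetSum _ fun j _ => (hint j).fun_smul (u j)]
  ext i
  simp only [integral_smul, WithLp.ofLp_sum, WithLp.ofLp_smul, Finset.sum_apply, Pi.smul_apply,
    smul_eq_mul, Matrix.ofLp_toEuclideanCLM, Matrix.mulVec, dotProduct, meanJacobian, Matrix.of_apply]
  refine Finset.sum_congr rfl fun j _ => ?_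
  rw [mul_comm]
  congr 1
  exact ((EuclideanSpace.proj (𝕜 := ℝ) i).integral_comp_comm (hint j)).symm

/-- The nonsingularity hypothesis concerns the derivative of the mean, whereas `A` is the mean of
the derivative. They coincide: the mean difference quotient is continuous up to step zero, so along
each basis direction it tends to both. -/
lemma det_meanJacobian_ne_zero [IsProbabilityMeasure P] (hns : NonsingularMeanDeriv P g θ₀)
    (hint : Integrable (fun p => g p θ₀) P) {r : ℝ} (hr : 0 < r) {h : S → ℝ} (hh : Integrable h P)
    (hm : ∀ k : StepDir q r, AEMeasurable (fun p => diffQuot (g p) θ₀ k.1 k.2) P)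
    (hb : ∀ᵐ p ∂P, ∀ k : StepDir q r, ‖diffQuot (g p) θ₀ k.1 k.2‖ ≤ h p)
    (hc : Continuous fun k : StepDir q r => ∫ p, diffQuot (g p) θ₀ k.1 k.2 ∂P) :
    (meanJacobian P g θ₀).det ≠ 0 := by
  obtain ⟨hd, hdet⟩ := hns
  set G : Vec q → Vec q := fun θ => ∫ p, g p θ ∂P with hG
  have hquot : ∀ k : StepDir q r,
      (k.1 : ℝ) • ∫ p, diffQuot (g p) θ₀ k.1 k.2 ∂P = G (θ₀ + (k.1 : ℝ) • (k.2 : Vec q)) - G θ₀ := by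
    intro k
    have hi : Integrable (fun p => diffQuot (g p) θ₀ k.1 k.2) P :=
      hh.mono' (hm k).aestronglyMeasurable (hb.mono fun p hp => hp k)
    have hi' : Integrable (fun p => g p (θ₀ + (k.1 : ℝ) • (k.2 : Vec q))) P := by
      refine ((hi.smul (k.1 : ℝ)).add hint).congr (ae_of_all _ fun p => ?_)
      simp [smul_diffQuot]
    rw [← integral_smul, hG, ← integral_sub hi' hint]
    simp [smul_diffQuot]
  have hfd : fderiv ℝ G θ₀ = Matrix.toEuclideanCLM (𝕜 := ℝ) (meanJacobian P g θ₀) := by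
    have hbasis : ∀ j : Fin q, fderiv ℝ G θ₀ (EuclideanSpace.single j 1) =
        Matrix.toEuclideanCLM (𝕜 := ℝ) (meanJacobian P g θ₀) (EuclideanSpace.single j 1) := by
      intro j
      rw [← integral_diffQuot_zero hr.le hh hm hb]
      let v : Metric.closedBall (0 : Vec q) 1 := ⟨EuclideanSpace.single j 1, by simp⟩
      let τ : ℕ → Set.Icc (0 : ℝ) r := fun n => ⟨r / (n + 1), by positivity,
        div_le_self hr.le (by linarith [(Nat.cast_nonneg n : (0 : ℝ) ≤ n)])⟩
      have hτ' : Tendsto (fun n => (τ n : ℝ)) atTop (𝓝 0) :=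
        tendsto_const_div_atTop_nhds_zero_nat r |>.comp (tendsto_add_atTop_nat 1) |>.congr
          fun n => by simp [τ]
      have hτ : Tendsto τ atTop (𝓝 ⟨0, le_refl _, hr.le⟩) := tendsto_subtype_rng.2 hτ'
      have t1 : Tendsto (fun n => ∫ p, diffQuot (g p) θ₀ (τ n) v ∂P) atTop
          (𝓝 (∫ p, diffQuot (g p) θ₀ 0 v ∂P)) :=
        (hc.tendsto (⟨0, le_refl _, hr.le⟩, v)).comp (hτ.prodMk_nhds tendsto_const_nhds)
      refine tendsto_nhds_unique ?_ t1
      have hτ0 : ∀ n, (τ n : ℝ) ≠ 0 := fun n => by simp only [τ]; positivity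
      have t2 := (hd.hasFDerivAt.hasLineDerivAt (v : Vec q)).tendsto_slope_zero.comp
        (tendsto_nhdsWithin_iff.2 ⟨hτ', Eventually.of_forall hτ0⟩)
      refine t2.congr fun n => ?_
      have := hquot (τ n, v)
      simp only [Function.comp_apply]
      rw [← this, smul_smul, inv_mul_cancel₀ (hτ0 n), one_smul]
    refine ContinuousLinearMap.coe_injective
      ((EuclideanSpace.basisFun (Fin q) ℝ).toBasis.ext fun j => ?_)
    simpa using hbasis j
  rw [hfd] at hdet
  convert hdet
  rw [ContinuousLinearMap.det]
  exact (LinearMap.det_toLin (EuclideanSpace.basisFun (Fin q) ℝ).toBasis _).symm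

end MeanDerivative

/-! ### Diagonal weights as operators -/

section DiagMul

variable {q : ℕ}

@[simp]
lemma diagMul_apply (w : Fin q → ℝ) (v : Vec q) (i : Fin q) : diagMul w v i = w i * v i := by
  simp [diagMul, Matrix.mulVec_diagonal]

lemma diagMul_add (w : Fin q → ℝ) (v v' : Vec q) :
    diagMul w (v + v') = diagMul w v + diagMul w v' := by
  ext i; simp [mul_add]

lemma diagMul_smul (w : Fin q → ℝ) (t : ℝ) (v : Vec q) : diagMul w (t • v) = t • diagMul w v := by
  ext i; simp; ring

lemma diagMul_sub_left (w w' : Fin q → ℝ) (v : Vec q) :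
    diagMul (w - w') v = diagMul w v - diagMul w' v := by
  ext i; simp [sub_mul]

lemma norm_diagMul_le (w : Fin q → ℝ) (v : Vec q) : ‖diagMul w v‖ ≤ ‖w‖ * ‖v‖ := by
  rw [← sq_le_sq₀ (norm_nonneg _) (by positivity), mul_pow, EuclideanSpace.real_norm_sq_eq,
    EuclideanSpace.real_norm_sq_eq, Finset.mul_sum]
  refine Finset.sum_le_sum fun i _ => ?_
  rw [diagMul_apply, mul_pow]
  refine mul_le_mul_of_nonneg_right ?_ (sq_nonneg _)
  rw [← sq_abs]
  gcongr
  exact norm_le_pi_norm w i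

lemma tendsto_diagMul_zero {w : Fin q → ℝ} {W : ℕ → Fin q → ℝ} (hW : Tendsto W atTop (𝓝 w))
    {v : ℕ → Vec q} (hv : Tendsto v atTop (𝓝 0)) :
    Tendsto (fun n => diagMul (W n) (v n)) atTop (𝓝 0) := by
  refine squeeze_zero_norm (fun n => norm_diagMul_le (W n) (v n)) ?_
  simpa using hW.norm.mul hv.norm

end DiagMul

/-! ### Deterministic core: convergence of zeros and linearization -/

section Deterministic

variable {q : ℕ}

lemma tendsto_eval_of_tendstoUniformly {K E : Type*} [NormedAddCommGroup E]
    {F : ℕ → K → E} {f : K → E} (hF : TendstoUniformly F f atTop) (x : ℕ → K) :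
    Tendsto (fun n => F n (x n) - f (x n)) atTop (𝓝 0) := by
  rw [Metric.tendstoUniformly_iff] at hF
  rw [Metric.tendsto_nhds]
  intro ε hε
  filter_upwards [hF ε hε] with n hn
  have := hn (x n)
  rwa [dist_comm, dist_eq_norm, ← dist_zero_right] at this

/-- Zeros of uniformly convergent estimating equations converge to the zero of the limit. -/
lemma tendsto_of_estimating_zero {Θ : Set (Vec q)} (hΘ : IsCompact Θ) {θ₀ : Vec q}
    {a c : ℕ → Vec q → Vec q} {G : Vec q → Vec q}
    (ha : TendstoUniformly (fun n (θ : Θ) => a n θ) (fun θ : Θ => G θ) atTop)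
    (hc : TendstoUniformly (fun n (θ : Θ) => c n θ) (fun _ => 0) atTop)
    (hG : Continuous fun θ : Θ => G θ) (huniq : ∀ θ ∈ Θ, G θ = 0 → θ = θ₀)
    {w : Fin q → ℝ} {W : ℕ → Fin q → ℝ} (hW : Tendsto W atTop (𝓝 w)) {θ : ℕ → Vec q}
    (hθ : ∀ᶠ n in atTop, θ n ∈ Θ ∧ a n (θ n) + diagMul (W n) (c n (θ n)) = 0) :
    Tendsto θ atTop (𝓝 θ₀) := by
  refine hΘ.tendsto_nhds_of_unique_mapClusterPt (hθ.mono fun n h => h.1) fun θ' hθ' hcl => ?_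
  refine huniq θ' hθ' ?_
  classical
  -- A sequence valued in `Θ`, to which the uniform limits apply; the cluster point is the default
  -- at the indices where `θ n` lies outside `Θ`.
  have hx : ∃ x : ℕ → Θ, ∀ᶠ n in atTop, (x n : Vec q) = θ n := by
    refine ⟨fun n => if h : θ n ∈ Θ then ⟨θ n, h⟩ else ⟨θ', hθ'⟩, ?_⟩
    filter_upwards [hθ] with n hn
    simp [hn.1]
  obtain ⟨x, hx⟩ := hx
  have hGx : Tendsto (fun n => G (x n)) atTop (𝓝 0) := by
    have h1 := tendsto_eval_of_tendstoUniformly ha x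
    have h2 := tendsto_eval_of_tendstoUniformly hc x
    simp only [sub_zero] at h2
    have h3 := tendsto_diagMul_zero hW h2
    have h4 := (h1.add h3).neg
    rw [add_zero, neg_zero] at h4
    refine h4.congr' ?_
    filter_upwards [hx, hθ] with n hn hn'
    rw [hn] at *
    have := hn'.2
    rw [sub_add_eq_add_sub, this]
    simp
  obtain ⟨φ, hφ, hlim⟩ := hcl.tendsto_subseq
  have hxlim : Tendsto (fun n => x (φ n)) atTop (𝓝 ⟨θ', hθ'⟩) := by
    rw [tendsto_subtype_rng]
    refine hlim.congr' ?_
    filter_upwards [hφ.tendsto_atTop.eventually hx] with n hn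
    exact hn.symm
  exact tendsto_nhds_unique ((hG.tendsto ⟨θ', hθ'⟩).comp hxlim) (hGx.comp hφ.tendsto_atTop)

/-- The displacement `δ` as a step and a direction, with the step truncated at `r`. -/
def stepOf {r : ℝ} (hr : 0 ≤ r) (δ : Vec q) : StepDir q r :=
  (⟨min ‖δ‖ r, le_min (norm_nonneg _) hr, min_le_right _ _⟩,
    ⟨‖δ‖⁻¹ • δ, by
      rw [mem_closedBall_zero_iff, norm_smul, norm_inv, norm_norm]
      exact inv_mul_le_one⟩)

lemma stepOf_smul {r : ℝ} (hr : 0 ≤ r) {δ : Vec q} (hδ : ‖δ‖ ≤ r) :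
    ((stepOf hr δ).1 : ℝ) • ((stepOf hr δ).2 : Vec q) = δ := by
  simp only [stepOf, min_eq_left hδ]
  rcases eq_or_ne δ 0 with rfl | h
  · simp
  · rw [smul_smul, mul_inv_cancel₀ (norm_ne_zero_iff.2 h), one_smul]

/-- Linearization of the estimating equations at `θ₀`, with an error that is negligible with respect
to any bound `d` of the equations at `θ₀`. -/
lemma tendsto_linearization_error {θ₀ : Vec q} {r : ℝ} (hr : 0 < r)
    {a c : ℕ → Vec q → Vec q} {A C : ℕ → StepDir q r → Vec q} {H : StepDir q r → Vec q}
    (hA : TendstoUniformly A H atTop) (hC : TendstoUniformly C (fun _ => 0) atTop)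
    (hH : Continuous H)
    (haA : ∀ n (k : StepDir q r), a n (θ₀ + (k.1 : ℝ) • (k.2 : Vec q)) = a n θ₀ + (k.1 : ℝ) • A n k)
    (hcC : ∀ n (k : StepDir q r), c n (θ₀ + (k.1 : ℝ) • (k.2 : Vec q)) = c n θ₀ + (k.1 : ℝ) • C n k)
    {J B : Vec q →L[ℝ] Vec q} (hBJ : ∀ v, B (J v) = v)
    (hHJ : ∀ u, H (⟨0, le_refl _, hr.le⟩, u) = J u)
    {w : Fin q → ℝ} {W : ℕ → Fin q → ℝ} (hW : Tendsto W atTop (𝓝 w)) {θ : ℕ → Vec q}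
    (hθ : Tendsto θ atTop (𝓝 θ₀))
    (hz : ∀ᶠ n in atTop, a n (θ n) + diagMul (W n) (c n (θ n)) = 0)
    {d : ℕ → ℝ} (hd : ∀ n, 0 < d n) (hda : ∀ n, ‖a n θ₀‖ + ‖c n θ₀‖ ≤ d n) :
    Tendsto (fun n => ‖J (θ n - θ₀) + (a n θ₀ + diagMul w (c n θ₀))‖ / d n) atTop (𝓝 0) := by
  set x : ℕ → StepDir q r := fun n => stepOf hr.le (θ n - θ₀) with hx
  have hδ : Tendsto (fun n => ‖θ n - θ₀‖) atTop (𝓝 0) := by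
    simpa using (hθ.sub_const θ₀).norm
  have hδr : ∀ᶠ n in atTop, ‖θ n - θ₀‖ ≤ r := hδ.eventually_le_const hr
  set x0 : ℕ → StepDir q r := fun n => (⟨0, le_refl _, hr.le⟩, (x n).2) with hx0
  set e : ℕ → Vec q := fun n => A n (x n) + diagMul (W n) (C n (x n)) - H (x0 n) with he
  have he0 : Tendsto e atTop (𝓝 0) := by
    have h1 := tendsto_eval_of_tendstoUniformly hA x
    have h2 := tendsto_eval_of_tendstoUniformly hC x
    simp only [sub_zero] at h2
    have h3 := tendsto_diagMul_zero hW h2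
    have h4 : Tendsto (fun n => H (x n) - H (x0 n)) atTop (𝓝 0) := by
      -- `x n` and `x0 n` have the same direction and differ only in the vanishing step. The
      -- directions need not converge, hence the uniform continuity.
      have huc := CompactSpace.uniformContinuous_of_continuous hH
      rw [Metric.uniformContinuous_iff] at huc
      rw [Metric.tendsto_nhds]
      intro ε hε
      obtain ⟨η, hη, hηb⟩ := huc ε hε
      filter_upwards [hδ.eventually_lt_const hη] with n hn
      rw [dist_zero_right, ← dist_eq_norm]
      refine hηb ?_
      rw [Prod.dist_eq, dist_self, max_eq_left dist_nonneg, Subtype.dist_eq, dist_zero_right]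
      simp only [hx, stepOf]
      rw [Real.norm_of_nonneg (le_min (norm_nonneg _) hr.le)]
      exact (min_le_left _ _).trans_lt hn
    have := (h1.add h3).add h4
    simp only [add_zero] at this
    refine this.congr fun n => ?_
    simp only [he]
    abel
  have hlin : ∀ᶠ n in atTop, J (θ n - θ₀) + (a n θ₀ + diagMul (W n) (c n θ₀)) =
      -(‖θ n - θ₀‖ • e n) := by
    filter_upwards [hz, hδr] with n hn hnr
    have hst := stepOf_smul hr.le hnr
    have hθn : θ n = θ₀ + ((x n).1 : ℝ) • ((x n).2 : Vec q) := by rw [hx, hst]; abel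
    have ht : ((x n).1 : ℝ) = ‖θ n - θ₀‖ := by simp [hx, stepOf, min_eq_left hnr]
    have hJ : J (θ n - θ₀) = ((x n).1 : ℝ) • H (x0 n) := by
      conv_lhs => rw [← hst]
      rw [map_smul, hx0, hHJ]
    rw [hθn, haA, hcC, diagMul_add, diagMul_smul] at hn
    rw [hJ, ← ht, ← sub_eq_zero]
    refine Eq.trans ?_ hn
    simp only [he, smul_sub, smul_add]
    abel
  -- Once `‖W n - w‖ ≤ 1`, the equation at `θ₀` is at most `(‖w‖ + 2) * d n`. Applying `B` bounds
  -- the displacement by this times `‖B‖`, plus `‖B‖ * ‖e n‖ ≤ 1 / 2` times itself; absorbing that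
  -- term gives the factor 2.
  set κ := 2 * ‖B‖ * (‖w‖ + 2) with hκ
  have hup : Tendsto (fun n => κ * ‖e n‖ + ‖W n - w‖) atTop (𝓝 0) := by
    have := (he0.norm.const_mul κ).add (hW.sub_const w).norm
    simpa using this
  have hWw : ∀ᶠ n in atTop, ‖W n - w‖ ≤ 1 := by
    have : Tendsto (fun n => ‖W n - w‖) atTop (𝓝 0) := by simpa using (hW.sub_const w).norm
    exact this.eventually_le_const one_pos
  have heB : ∀ᶠ n in atTop, ‖B‖ * ‖e n‖ ≤ 1 / 2 := by
    have : Tendsto (fun n => ‖B‖ * ‖e n‖) atTop (𝓝 0) := by simpa using he0.norm.const_mul ‖B‖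
    exact this.eventually_le_const (by norm_num)
  refine tendsto_of_tendsto_of_tendsto_of_le_of_le' tendsto_const_nhds hup
    (Eventually.of_forall fun n => div_nonneg (norm_nonneg _) (hd n).le) ?_
  filter_upwards [hlin, hWw, heB] with n hn hnW hnB
  have hWn : ‖W n‖ ≤ ‖w‖ + 1 := by
    calc ‖W n‖ = ‖(W n - w) + w‖ := by rw [sub_add_cancel]
      _ ≤ ‖W n - w‖ + ‖w‖ := norm_add_le _ _
      _ ≤ ‖w‖ + 1 := by linarith
  have hΨ : ‖a n θ₀ + diagMul (W n) (c n θ₀)‖ ≤ (‖w‖ + 2) * d n := by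
    calc _ ≤ ‖a n θ₀‖ + ‖W n‖ * ‖c n θ₀‖ := (norm_add_le _ _).trans (by
          gcongr; exact norm_diagMul_le _ _)
      _ ≤ ‖a n θ₀‖ + (‖w‖ + 1) * ‖c n θ₀‖ := by gcongr
      _ ≤ (‖w‖ + 2) * (‖a n θ₀‖ + ‖c n θ₀‖) := by
          nlinarith [norm_nonneg (a n θ₀), norm_nonneg (c n θ₀), norm_nonneg w,
            mul_nonneg (norm_nonneg w) (norm_nonneg (a n θ₀))]
      _ ≤ _ := by gcongr; exact hda n
  have hδn : ‖θ n - θ₀‖ ≤ κ * d n := by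
    have hJ : J (θ n - θ₀) = -(‖θ n - θ₀‖ • e n) - (a n θ₀ + diagMul (W n) (c n θ₀)) :=
      eq_sub_of_add_eq hn
    have h1 : ‖θ n - θ₀‖ ≤ ‖B‖ * (‖θ n - θ₀‖ * ‖e n‖ + (‖w‖ + 2) * d n) := by
      calc ‖θ n - θ₀‖ = ‖B (J (θ n - θ₀))‖ := by rw [hBJ]
        _ ≤ ‖B‖ * ‖J (θ n - θ₀)‖ := B.le_opNorm _
        _ ≤ _ := by
          gcongr
          rw [hJ]
          refine (norm_sub_le _ _).trans ?_
          rw [norm_neg, norm_smul, norm_norm]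
          gcongr
    have h2 := mul_le_mul_of_nonneg_left hnB (norm_nonneg (θ n - θ₀))
    rw [hκ]
    nlinarith
  have hfin : J (θ n - θ₀) + (a n θ₀ + diagMul w (c n θ₀)) =
      -(‖θ n - θ₀‖ • e n) - diagMul (W n - w) (c n θ₀) := by
    rw [← hn, diagMul_sub_left]
    abel
  rw [div_le_iff₀ (hd n), hfin]
  calc _ ≤ ‖θ n - θ₀‖ * ‖e n‖ + ‖W n - w‖ * ‖c n θ₀‖ := by
        refine (norm_sub_le _ _).trans ?_
        rw [norm_neg, norm_smul, norm_norm]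
        gcongr
        exact norm_diagMul_le _ _
    _ ≤ κ * d n * ‖e n‖ + ‖W n - w‖ * d n := by
        gcongr
        exact (le_add_of_nonneg_left (norm_nonneg _)).trans (hda n)
    _ = _ := by ring

end Deterministic

/-! ### From almost sure to in-probability convergence -/

section Subsequence

variable {Ω E F : Type*} [MeasurableSpace Ω] {μ : Measure Ω} [IsProbabilityMeasure μ]
  [PseudoEMetricSpace F]

/-- Convergence in probability follows from almost sure convergence along the subsequences on which
a given consistent sequence converges and given events of vanishing probability stop occurring. -/
lemma tendstoInMeasure_of_subseq [PseudoEMetricSpace E] {X : ℕ → Ω → E}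
    (hX : ∀ n, AEStronglyMeasurable (X n) μ) {x : E} {W : ℕ → Ω → F} {w : F}
    (hW : TendstoInMeasure μ W atTop fun _ => w) {good : ℕ → Ω → Prop}
    (hgood : Tendsto (fun n => μ {s | ¬ good n s}) atTop (𝓝 0))
    (h : ∀ᵐ s ∂μ, ∀ ns : ℕ → ℕ, StrictMono ns → Tendsto (fun k => W (ns k) s) atTop (𝓝 w) →
      (∀ᶠ k in atTop, good (ns k) s) → Tendsto (fun k => X (ns k) s) atTop (𝓝 x)) :
    TendstoInMeasure μ X atTop fun _ => x := by
  rw [exists_seq_tendstoInMeasure_atTop_iff hX]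
  intro ns hns
  obtain ⟨ns₁, hns₁, hlim₁⟩ := (hW.comp hns.tendsto_atTop).exists_seq_tendsto_ae
  let I : ℕ → Ω → ℝ := fun n => {s | ¬ good n s}.indicator fun _ => 1
  have hI : TendstoInMeasure μ I atTop fun _ => (0 : ℝ) := by
    intro ε hε
    refine tendsto_of_tendsto_of_tendsto_of_le_of_le tendsto_const_nhds hgood
      (fun _ => zero_le) fun n => measure_mono fun s hs => ?_
    by_contra hg
    have : I n s = 0 := Set.indicator_of_notMem hg _
    simp only [Set.mem_ofPred_eq, this, edist_self] at hs
    exact absurd hs (not_le.2 hε)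
  obtain ⟨ns₂, hns₂, hlim₂⟩ :=
    (hI.comp (hns.comp hns₁).tendsto_atTop).exists_seq_tendsto_ae
  refine ⟨ns₁ ∘ ns₂, hns₁.comp hns₂, ?_⟩
  filter_upwards [h, hlim₁, hlim₂] with s hs h1 h2
  refine hs (ns ∘ ns₁ ∘ ns₂) (hns.comp (hns₁.comp hns₂)) (h1.comp hns₂.tendsto_atTop) ?_
  filter_upwards [h2.eventually_lt_const (one_pos)] with k hk
  by_contra hg
  have : I (ns (ns₁ (ns₂ k))) s = 1 := Set.indicator_of_mem (a := s) hg _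
  simp only [Function.comp_apply, this] at hk
  exact lt_irrefl _ hk

end Subsequence

/-! ### Cross-covariance algebra and the asymptotic covariance -/

section CrossCovariance

variable {q : ℕ} {S : Type*} [MeasurableSpace S] {P : Measure S}
  {f f' g g' : S → Vec q}

lemma memLp_coord (hf : MemLp f 2 P) (i : Fin q) : MemLp (fun p => f p i) 2 P :=
  (EuclideanSpace.proj (𝕜 := ℝ) i).comp_memLp' hf

lemma crossCov_add_left [IsProbabilityMeasure P]
    (hf : MemLp f 2 P) (hf' : MemLp f' 2 P) (hg : MemLp g 2 P) :
    crossCov P (fun p => f p + f' p) g = crossCov P f g + crossCov P f' g := by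
  ext i j
  exact covariance_add_left (memLp_coord hf i) (memLp_coord hf' i) (memLp_coord hg j)

lemma crossCov_transpose : (crossCov P f g).transpose = crossCov P g f := by
  ext i j
  exact covariance_comm _ _

lemma crossCov_add_right [IsProbabilityMeasure P]
    (hf : MemLp f 2 P) (hg : MemLp g 2 P) (hg' : MemLp g' 2 P) :
    crossCov P f (fun p => g p + g' p) = crossCov P f g + crossCov P f g' := by
  rw [← crossCov_transpose, crossCov_add_left hg hg' hf, Matrix.transpose_add, crossCov_transpose,
    crossCov_transpose]

lemma memLp_toEuclideanCLM (M : Matrix (Fin q) (Fin q) ℝ) (hf : MemLp f 2 P) :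
    MemLp (fun p => Matrix.toEuclideanCLM (𝕜 := ℝ) M (f p)) 2 P :=
  (Matrix.toEuclideanCLM (𝕜 := ℝ) M).comp_memLp' hf

lemma crossCov_toEuclideanCLM_left [IsProbabilityMeasure P]
    (M : Matrix (Fin q) (Fin q) ℝ) (hf : MemLp f 2 P)
    (hg : MemLp g 2 P) :
    crossCov P (fun p => Matrix.toEuclideanCLM (𝕜 := ℝ) M (f p)) g = M * crossCov P f g := by
  ext i j
  simp only [crossCov, Matrix.of_apply, Matrix.mul_apply, Matrix.ofLp_toEuclideanCLM,
    Matrix.mulVec, dotProduct]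
  rw [covariance_fun_sum_left (fun k => (memLp_coord hf k).const_mul _) (memLp_coord hg j)]
  exact Finset.sum_congr rfl fun k _ => covariance_const_mul_left _

lemma crossCov_toEuclideanCLM_right [IsProbabilityMeasure P]
    (M : Matrix (Fin q) (Fin q) ℝ) (hf : MemLp f 2 P)
    (hg : MemLp g 2 P) :
    crossCov P f (fun p => Matrix.toEuclideanCLM (𝕜 := ℝ) M (g p)) =
      crossCov P f g * M.transpose := by
  rw [← crossCov_transpose, crossCov_toEuclideanCLM_left M hg hf, Matrix.transpose_mul,
    crossCov_transpose]

/-- Serves both positive semidefiniteness and the matching of the scalar variances in the Gaussian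
characteristic function. -/
lemma dotProduct_crossCov_mulVec [IsProbabilityMeasure P]
    (hf : MemLp f 2 P) (t : Fin q → ℝ) :
    t ⬝ᵥ (crossCov P f f).mulVec t = Var[fun p => inner ℝ (f p) (WithLp.toLp 2 t); P] := by
  have h1 : ∀ p, inner ℝ (f p) (WithLp.toLp 2 t) = ∑ i, t i * f p i := fun p => by
    simp [PiLp.inner_apply]
  have hm : ∀ i, MemLp (fun p => t i * f p i) 2 P := fun i => (memLp_coord hf i).const_mul _
  simp only [h1]
  rw [← covariance_self (memLp_finsetSum _ fun i _ => hm i).1.aemeasurable,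
    covariance_fun_sum_fun_sum hm hm]
  simp only [covariance_const_mul_left, covariance_const_mul_right, dotProduct, Matrix.mulVec,
    crossCov, Matrix.of_apply, Finset.mul_sum]
  exact Finset.sum_congr rfl fun i _ => Finset.sum_congr rfl fun j _ => by ring

lemma posSemidef_crossCov [IsProbabilityMeasure P]
    (hf : MemLp f 2 P) : (crossCov P f f).PosSemidef := by
  refine Matrix.PosSemidef.of_dotProduct_mulVec_nonneg ?_ fun t => ?_
  · rw [Matrix.IsHermitian, Matrix.conjTranspose_eq_transpose_of_trivial, crossCov_transpose]
  · rw [star_trivial, dotProduct_crossCov_mulVec hf]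
    exact variance_nonneg _ _

end CrossCovariance

lemma diagMul_eq_toEuclideanCLM {q : ℕ} (w : Fin q → ℝ) (v : Vec q) :
    diagMul w v = Matrix.toEuclideanCLM (𝕜 := ℝ) (Matrix.diagonal w) v := by
  ext i
  simp [Matrix.mulVec_diagonal]

/-- The asymptotic covariance as the covariance of the influence function of a labeled observation
plus `ρ` times that of an unlabeled one. -/
lemma asympCov_eq {d q : ℕ} {Z : Type*} [MeasurableSpace Z] {P : Measure (Obs d Z)}
    [IsProbabilityMeasure P] {psi : ℝ → Vec d → Vec q → Vec q} {qhat : Z → Vec d} {θ₀ : Vec q}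
    (hf : MemLp (fun p => score psi p θ₀) 2 P) (hg : MemLp (fun p => predScore psi qhat p θ₀) 2 P)
    (ρ : ℝ) (w : Fin q → ℝ) :
    asympCov P psi qhat θ₀ ρ w =
      crossCov P
        (fun p => Matrix.toEuclideanCLM (𝕜 := ℝ) (-(A P psi θ₀)⁻¹) (score psi p θ₀ +
          Matrix.toEuclideanCLM (𝕜 := ℝ) (-Matrix.diagonal w) (predScore psi qhat p θ₀)))
        (fun p => Matrix.toEuclideanCLM (𝕜 := ℝ) (-(A P psi θ₀)⁻¹) (score psi p θ₀ +
          Matrix.toEuclideanCLM (𝕜 := ℝ) (-Matrix.diagonal w) (predScore psi qhat p θ₀))) +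
      ρ • crossCov P
        (fun p => Matrix.toEuclideanCLM (𝕜 := ℝ) (-(A P psi θ₀)⁻¹)
          (Matrix.toEuclideanCLM (𝕜 := ℝ) (Matrix.diagonal w) (predScore psi qhat p θ₀)))
        (fun p => Matrix.toEuclideanCLM (𝕜 := ℝ) (-(A P psi θ₀)⁻¹)
          (Matrix.toEuclideanCLM (𝕜 := ℝ) (Matrix.diagonal w) (predScore psi qhat p θ₀))) := by
  have hWg := memLp_toEuclideanCLM (-Matrix.diagonal w) hg
  have hWg' := memLp_toEuclideanCLM (Matrix.diagonal w) hg
  have hs : MemLp (fun p => score psi p θ₀ +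
      Matrix.toEuclideanCLM (𝕜 := ℝ) (-Matrix.diagonal w) (predScore psi qhat p θ₀)) 2 P :=
    hf.add hWg
  rw [crossCov_toEuclideanCLM_left _ hs (memLp_toEuclideanCLM _ hs),
    crossCov_toEuclideanCLM_right _ hs hs,
    crossCov_add_left hf hWg hs, crossCov_add_right hf hf hWg, crossCov_add_right hWg hf hWg,
    crossCov_toEuclideanCLM_left _ hWg' (memLp_toEuclideanCLM _ hWg'),
    crossCov_toEuclideanCLM_right _ hWg' hWg',
    crossCov_toEuclideanCLM_left _ hg hf, crossCov_toEuclideanCLM_left _ hg hWg,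
    crossCov_toEuclideanCLM_right _ hg hg, crossCov_toEuclideanCLM_right _ hf hg,
    crossCov_toEuclideanCLM_left _ hg hWg', crossCov_toEuclideanCLM_right _ hg hg]
  simp only [asympCov, V, M1, M2, M3, M4, crossCov_transpose, Matrix.transpose_neg,
    Matrix.diagonal_transpose]
  simp only [Matrix.neg_mul, Matrix.mul_neg, neg_neg, Matrix.mul_add, Matrix.add_mul,
    Matrix.mul_sub, Matrix.sub_mul, Matrix.mul_assoc, Matrix.smul_mul, Matrix.mul_smul]
  abel

/-! ### Two-block limit with explicit covariance -/

section TwoSample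

variable {q : ℕ} {S Ω : Type*} [MeasurableSpace S] [MeasurableSpace Ω] {P : Measure S}
  {μ : Measure Ω} {D : ℕ → Ω → S}

/-- Central limit theorem for the sum of the averages over the labeled and the unlabeled block, with
the explicit limit covariance. -/
theorem tendstoInDistribution_two_sample_crossCov [IsProbabilityMeasure P] [IsProbabilityMeasure μ]
    (hlaw : ∀ i, HasLaw (D i) P μ) (hindep : iIndepFun D μ)
    {N : ℕ → ℕ} (hN : Tendsto N atTop atTop) {ρ : ℝ}
    (hρ : Tendsto (fun n : ℕ => (n : ℝ) / (N n : ℝ)) atTop (𝓝 ρ))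
    {ξ η : S → Vec q} (hξ : MemLp ξ 2 P) (hη : MemLp η 2 P)
    (h0 : ∫ p, ξ p ∂P + ∫ p, η p ∂P = 0) :
    (crossCov P ξ ξ + ρ • crossCov P η η).PosSemidef ∧
    TendstoInDistribution (fun (n : ℕ) s => √n • ((n : ℝ)⁻¹ • ∑ i ∈ Finset.range n, ξ (D i s) +
        (N n : ℝ)⁻¹ • ∑ i ∈ Finset.Ico n (n + N n), η (D i s))) atTop
      id (fun _ => μ) (multivariateGaussian 0 (crossCov P ξ ξ + ρ • crossCov P η η)) := by
  have hρ0 : 0 ≤ ρ := ge_of_tendsto' hρ fun n => by positivity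
  have hpsd := (posSemidef_crossCov hξ).add ((posSemidef_crossCov hη).smul hρ0)
  refine ⟨hpsd, tendstoInDistribution_two_sample hlaw hindep hN hρ hξ hη h0 hpsd fun t => ?_⟩
  rw [Matrix.add_mulVec, dotProduct_add, Matrix.smul_mulVec, dotProduct_smul,
    dotProduct_crossCov_mulVec hξ, dotProduct_crossCov_mulVec hη]
  rfl

end TwoSample

/-! ### Calculus of terms vanishing in probability -/

section StochasticOrder

variable {Ω : Type*} [MeasurableSpace Ω] {μ : Measure Ω}

lemma tendstoInMeasure_add_zero {E : Type*} [SeminormedAddCommGroup E] {X Y : ℕ → Ω → E}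
    (hX : TendstoInMeasure μ X atTop fun _ => 0) (hY : TendstoInMeasure μ Y atTop fun _ => 0) :
    TendstoInMeasure μ (fun n s => X n s + Y n s) atTop fun _ => 0 := by
  rw [tendstoInMeasure_iff_norm] at *
  intro ε hε
  have h := (hX _ (half_pos hε)).add (hY _ (half_pos hε))
  rw [add_zero] at h
  refine tendsto_of_tendsto_of_tendsto_of_le_of_le tendsto_const_nhds h (fun _ => zero_le)
    fun n => (measure_mono fun s hs => ?_).trans (measure_union_le _ _)
  simp only [sub_zero, Set.mem_ofPred_eq, Set.mem_union] at hs ⊢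
  by_contra! hcon
  linarith [norm_add_le (X n s) (Y n s)]

lemma tendstoInMeasure_zero_of_norm_le {E : Type*} [SeminormedAddCommGroup E] {X : ℕ → Ω → E}
    {Y : ℕ → Ω → ℝ} (hY : TendstoInMeasure μ Y atTop fun _ => 0)
    (hXY : ∀ n s, ‖X n s‖ ≤ Y n s) : TendstoInMeasure μ X atTop fun _ => 0 := by
  rw [tendstoInMeasure_iff_norm] at *
  intro ε hε
  refine tendsto_of_tendsto_of_tendsto_of_le_of_le tendsto_const_nhds (hY ε hε) (fun _ => zero_le)
    fun n => measure_mono fun s hs => ?_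
  simp only [sub_zero, Set.mem_ofPred_eq] at hs ⊢
  exact hs.trans ((hXY n s).trans (Real.le_norm_self _))

/-- A sequence that vanishes in probability times one that converges in distribution vanishes in
probability. -/
lemma tendstoInMeasure_mul_norm [IsProbabilityMeasure μ] {E : Type*} [NormedAddCommGroup E]
    [MeasurableSpace E] [BorelSpace E] [SecondCountableTopology E] {Ω' : Type*}
    [MeasurableSpace Ω'] {ν : Measure Ω'} [IsProbabilityMeasure ν] {r : ℕ → Ω → ℝ}
    (hrm : ∀ n, AEMeasurable (r n) μ) (hr : TendstoInMeasure μ r atTop fun _ => 0)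
    {Y : ℕ → Ω → E} {Y₀ : Ω' → E} (hY : TendstoInDistribution Y atTop Y₀ (fun _ => μ) ν) :
    TendstoInMeasure μ (fun n s => r n s * ‖Y n s‖) atTop fun _ => 0 := by
  have h := hY.continuous_comp_prodMk_of_tendstoInMeasure_const (g := fun p : E × ℝ => p.2 * ‖p.1‖)
    (by fun_prop) hr hrm
  rw [tendstoInMeasure_iff_norm]
  intro ε hε
  have hcl : IsClosed {x : ℝ | ε ≤ ‖x‖} := isClosed_le continuous_const continuous_norm
  -- The limit law is the point mass at 0, so this closed set and its frontier are null and the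
  -- portmanteau theorem applies.
  have hν : ν.map (fun ω => (Y₀ ω, (0 : ℝ)).2 * ‖(Y₀ ω, (0 : ℝ)).1‖) {x : ℝ | ε ≤ ‖x‖} = 0 := by
    simp [hε]
  have hfr := measure_mono_null hcl.frontier_subset hν
  have key := ProbabilityMeasure.tendsto_measure_of_null_frontier_of_tendsto' h.tendsto hfr
  simp only [ProbabilityMeasure.coe_mk] at key
  rw [hν] at key
  refine key.congr fun n => ?_
  rw [Measure.map_apply_of_aemeasurable (h.forall_aemeasurable n) hcl.measurableSet]
  simp

end StochasticOrder

/-! ### The two averages in the estimating equation -/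

section Averages

variable {d q : ℕ} {Z : Type*}

/-- The labeled average of the score. -/
def scoreAvg (psi : ℝ → Vec d → Vec q → Vec q) (n : ℕ) (D : ℕ → Obs d Z) (θ : Vec q) : Vec q :=
  (n : ℝ)⁻¹ • ∑ i ∈ Finset.range n, score psi (D i) θ

/-- The unlabeled average of the predicted score minus the labeled one. -/
def predContrast (psi : ℝ → Vec d → Vec q → Vec q) (qhat : Z → Vec d) (n N : ℕ) (D : ℕ → Obs d Z)
    (θ : Vec q) : Vec q :=
  -((n : ℝ)⁻¹ • ∑ i ∈ Finset.range n, predScore psi qhat (D i) θ)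
    + (N : ℝ)⁻¹ • ∑ i ∈ Finset.Ico n (n + N), predScore psi qhat (D i) θ

/-- An exact expansion with no remainder: the error is carried by the average of the difference
quotients, which the uniform law controls. -/
lemma average_step {S : Type*} (g : S → Vec q → Vec q) (D : ℕ → S) (b : ℝ) (I : Finset ℕ)
    (θ₀ : Vec q) (t : ℝ) (u : Vec q) :
    b • ∑ i ∈ I, g (D i) (θ₀ + t • u) =
      b • ∑ i ∈ I, g (D i) θ₀ + t • (b • ∑ i ∈ I, diffQuot (g (D i)) θ₀ t u) := by
  rw [smul_comm t b, ← smul_add]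
  congr 1
  rw [Finset.smul_sum, ← Finset.sum_add_distrib]
  simp [smul_diffQuot]

variable [MeasurableSpace Z] {psi : ℝ → Vec d → Vec q → Vec q} {qhat : Z → Vec d}

lemma measurable_score (hpsi : ∀ θ : Vec q, Measurable fun p : ℝ × Vec d => psi p.1 p.2 θ)
    (θ : Vec q) : Measurable fun p : Obs d Z => score psi p θ :=
  (hpsi θ).comp (measurable_fst.prodMk (measurable_fst.comp measurable_snd))

lemma measurable_predScore (hpsi : ∀ θ : Vec q, Measurable fun p : ℝ × Vec d => psi p.1 p.2 θ)
    (hqhat : Measurable qhat) (θ : Vec q) :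
    Measurable fun p : Obs d Z => predScore psi qhat p θ :=
  (hpsi θ).comp (measurable_fst.prodMk (hqhat.comp (measurable_snd.comp measurable_snd)))

lemma MomentBounds.memLp {S : Type*} [MeasurableSpace S] {P : Measure S} {g : S → Vec q → Vec q}
    {Θ : Set (Vec q)} (h : MomentBounds P g Θ) {θ : Vec q} (hθ : θ ∈ Θ)
    (hg : Measurable fun p => g p θ) : MemLp (fun p => g p θ) 2 P := by
  refine ⟨hg.aestronglyMeasurable, ?_⟩
  rw [eLpNorm_lt_top_iff_lintegral_rpow_enorm_lt_top (by norm_num) (by norm_num)]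
  refine lt_of_le_of_lt ?_ h.secondMoment
  refine le_trans (le_of_eq ?_) (le_iSup₂ (f := fun θ _ => ∫⁻ p, ‖g p θ‖ₑ ^ 2 ∂P) θ hθ)
  simp

end Averages

/-! ### Consistency, linearization and asymptotic normality -/

section Asymptotics

variable {d q : ℕ} {Z Ω : Type*} [MeasurableSpace Z] [MeasurableSpace Ω]
  {psi : ℝ → Vec d → Vec q → Vec q} {qhat : Z → Vec d} {Θ : Set (Vec q)} {θ₀ : Vec q}
  {P : Measure (Obs d Z)} {μ : Measure Ω} {D : ℕ → Ω → Obs d Z} {N : ℕ → ℕ} {ρ : ℝ}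

/-- The contrast between two uniformly consistent averages vanishes uniformly. -/
lemma tendstoUniformly_contrast {K E : Type*} [NormedAddCommGroup E] {X Y : ℕ → K → E} {f : K → E}
    (hX : TendstoUniformly X f atTop) (hY : TendstoUniformly Y f atTop) :
    TendstoUniformly (fun n k => -X n k + Y n k) (fun _ => 0) atTop := by
  have := hX.neg.add hY
  rwa [neg_add_cancel] at this

lemma tendstoUniformly_subseq {K E : Type*} [NormedAddCommGroup E] {X : ℕ → K → E} {f : K → E}
    (hX : TendstoUniformly X f atTop) {ns : ℕ → ℕ} (hns : StrictMono ns) :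
    TendstoUniformly (fun n => X (ns n)) f atTop :=
  fun U hU => hns.tendsto_atTop.eventually (hX U hU)

/-- Almost surely, the estimator converges to `θ₀` along all subsequences along which the weights
converge and the estimator eventually solves the estimating equation. -/
lemma ae_tendsto_estimator (hpsi : ∀ θ : Vec q, Measurable fun p : ℝ × Vec d => psi p.1 p.2 θ)
    (hqhat : Measurable qhat)
    (hlaw : ∀ i, HasLaw (D i) P μ) (hindep : iIndepFun D μ) (hN : Tendsto N atTop atTop)
    (hρ : Tendsto (fun n : ℕ => (n : ℝ) / (N n : ℝ)) atTop (𝓝 ρ))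
    (hident : Identified P (score psi) Θ θ₀)
    (hcont : ContinuousInParam P (score psi) Θ)
    (hcont' : ContinuousInParam P (predScore psi qhat) Θ)
    (hmom : MomentBounds P (score psi) Θ) (hmom' : MomentBounds P (predScore psi qhat) Θ)
    (w : Fin q → ℝ) (what : ℕ → Ω → Fin q → ℝ) (θhat : ℕ → Ω → Vec q) :
    ∀ᵐ s ∂μ, ∀ ns : ℕ → ℕ, StrictMono ns → Tendsto (fun k => what (ns k) s) atTop (𝓝 w) →
      (∀ᶠ k in atTop, θhat (ns k) s ∈ Θ ∧ estEq psi qhat (ns k) (N (ns k)) (fun i => D i s)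
        (what (ns k) s) (θhat (ns k) s) = 0) →
      Tendsto (fun k => θhat (ns k) s) atTop (𝓝 θ₀) := by
  have : CompactSpace Θ := isCompact_iff_compactSpace.1 hident.isCompact
  obtain ⟨h, hh, hb⟩ := hmom.envelope
  obtain ⟨h', hh', hb'⟩ := hmom'.envelope
  have hm := fun θ : Θ => (measurable_score (Z := Z) hpsi θ).aemeasurable (μ := P)
  have hm' := fun θ : Θ => (measurable_predScore hpsi hqhat θ).aemeasurable (μ := P)
  have hc : ∀ᵐ p ∂P, Continuous fun θ : Θ => score psi p θ :=
    hcont.mono fun p hp => continuousOn_iff_continuous_domRestrict.1 hp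
  have hc' : ∀ᵐ p ∂P, Continuous fun θ : Θ => predScore psi qhat p θ :=
    hcont'.mono fun p hp => continuousOn_iff_continuous_domRestrict.1 hp
  have hb₁ : ∀ᵐ p ∂P, ∀ θ : Θ, ‖score psi p θ‖ ≤ h p := hb.mono fun p hp θ => hp θ θ.2
  have hb₁' : ∀ᵐ p ∂P, ∀ θ : Θ, ‖predScore psi qhat p θ‖ ≤ h' p := hb'.mono fun p hp θ => hp θ θ.2
  obtain ⟨hG, h1⟩ := ae_tendstoUniformly_average hlaw hindep hm hc hh hb₁
  have h2 := (ae_tendstoUniformly_average hlaw hindep hm' hc' hh' hb₁').2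
  have h3 := ae_tendstoUniformly_average_Ico hlaw hindep hN hρ hm' hc' hh' hb₁'
  filter_upwards [h1, h2, h3] with s h1 h2 h3 ns hns hw hθ
  exact tendsto_of_estimating_zero hident.isCompact
    (a := fun k => scoreAvg psi (ns k) fun i => D i s)
    (c := fun k => predContrast psi qhat (ns k) (N (ns k)) fun i => D i s)
    (G := fun θ => ∫ p, score psi p θ ∂P) (tendstoUniformly_subseq h1 hns)
    (tendstoUniformly_subseq (tendstoUniformly_contrast h2 h3) hns) hG hident.unique hw hθ

variable [IsProbabilityMeasure μ]

/-- The linearization error of the estimating equation at `θ₀` vanishes relative to the size of the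
estimating equation at `θ₀`. -/
lemma tendstoInMeasure_linearization_error
    (hpsi : ∀ θ : Vec q, Measurable fun p : ℝ × Vec d => psi p.1 p.2 θ)
    (hqhat : Measurable qhat)
    (hlaw : ∀ i, HasLaw (D i) P μ) (hindep : iIndepFun D μ) (hN : Tendsto N atTop atTop)
    (hρ : Tendsto (fun n : ℕ => (n : ℝ) / (N n : ℝ)) atTop (𝓝 ρ))
    (hident : Identified P (score psi) Θ θ₀)
    (hcont : ContinuousInParam P (score psi) Θ)
    (hcont' : ContinuousInParam P (predScore psi qhat) Θ)
    (hmom : MomentBounds P (score psi) Θ) (hmom' : MomentBounds P (predScore psi qhat) Θ)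
    (hreg : LocallyRegular P (score psi) θ₀) (hreg' : LocallyRegular P (predScore psi qhat) θ₀)
    (hdet : (A P psi θ₀).det ≠ 0)
    {w : Fin q → ℝ} {what : ℕ → Ω → Fin q → ℝ}
    (hwhat : TendstoInMeasure μ what atTop (fun _ => w))
    {θhat : ℕ → Ω → Vec q} (hθhat_meas : ∀ n, AEMeasurable (θhat n) μ)
    (hθhat : Tendsto (fun n => μ {s | ¬ (θhat n s ∈ Θ ∧
      estEq psi qhat n (N n) (fun i => D i s) (what n s) (θhat n s) = 0)}) atTop (𝓝 0))
    (ha : ∀ n, AEMeasurable (fun s => scoreAvg psi n (fun i => D i s) θ₀) μ)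
    (hc : ∀ n, AEMeasurable (fun s => predContrast psi qhat n (N n) (fun i => D i s) θ₀) μ)
    {ε : ℕ → Ω → ℝ}
    (hε : ε = fun n s => ‖Matrix.toEuclideanCLM (𝕜 := ℝ) (A P psi θ₀) (θhat n s - θ₀) +
        (scoreAvg psi n (fun i => D i s) θ₀ +
          diagMul w (predContrast psi qhat n (N n) (fun i => D i s) θ₀))‖ /
        (‖scoreAvg psi n (fun i => D i s) θ₀‖ +
          ‖predContrast psi qhat n (N n) (fun i => D i s) θ₀‖ + ((n : ℝ) + 1)⁻¹)) :
    (∀ n, AEMeasurable (ε n) μ) ∧ TendstoInMeasure μ ε atTop fun _ => 0 := by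
  have hεm : ∀ n, AEMeasurable (ε n) μ := by
    intro n
    have h1 := ha n
    have h2 := hc n
    have h3 := hθhat_meas n
    simp only [hε, diagMul_eq_toEuclideanCLM]
    fun_prop
  refine ⟨hεm, ?_⟩
  obtain ⟨r₁, hr₁, h, hh, hQ⟩ := hreg.exists_diffQuot
    fun θ => (measurable_score hpsi θ).aemeasurable
  obtain ⟨r₂, hr₂, h', hh', hQ'⟩ := hreg'.exists_diffQuot
    fun θ => (measurable_predScore hpsi hqhat θ).aemeasurable
  -- A common radius, so that the score and the predicted score are expanded over the same steps and
  -- directions.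
  set r := min r₁ r₂
  have hr : 0 < r := lt_min hr₁ hr₂
  obtain ⟨hm, hcQ, hb⟩ := hQ r hr (min_le_left _ _)
  obtain ⟨hm', hcQ', hb'⟩ := hQ' r hr (min_le_right _ _)
  obtain ⟨hH, h1⟩ := ae_tendstoUniformly_average hlaw hindep hm hcQ hh hb
  have h2 := (ae_tendstoUniformly_average hlaw hindep hm' hcQ' hh' hb').2
  have h3 := ae_tendstoUniformly_average_Ico hlaw hindep hN hρ hm' hcQ' hh' hb'
  refine tendstoInMeasure_of_subseq (fun n => (hεm n).aestronglyMeasurable) hwhat hθhat ?_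
  filter_upwards [h1, h2, h3, ae_tendsto_estimator hpsi hqhat hlaw hindep hN hρ hident hcont hcont'
    hmom hmom' w what θhat] with s h1 h2 h3 hcons ns hns hw hθ
  have hBJ : ∀ v, Matrix.toEuclideanCLM (𝕜 := ℝ) (A P psi θ₀)⁻¹
      (Matrix.toEuclideanCLM (𝕜 := ℝ) (A P psi θ₀) v) = v := by
    intro v
    rw [← mul_apply_eq_comp, ← map_mul, Matrix.nonsing_inv_mul _ hdet.isUnit, map_one]
    rfl
  rw [hε]
  refine tendsto_linearization_error hr
    (a := fun k => scoreAvg psi (ns k) fun i => D i s)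
    (c := fun k => predContrast psi qhat (ns k) (N (ns k)) fun i => D i s)
    (tendstoUniformly_subseq h1 hns)
    (tendstoUniformly_subseq (tendstoUniformly_contrast h2 h3) hns) hH
    (fun k x => average_step _ _ _ _ _ _ _) (fun k x => ?_) hBJ
    (fun u => integral_diffQuot_zero hr.le hh hm hb u) hw (hcons ns hns hw hθ)
    (hθ.mono fun k hk => hk.2)
    (d := fun k => ‖scoreAvg psi (ns k) (fun i => D i s) θ₀‖ +
      ‖predContrast psi qhat (ns k) (N (ns k)) (fun i => D i s) θ₀‖ + ((ns k : ℝ) + 1)⁻¹)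
    (fun k => by positivity) (fun k => le_add_of_nonneg_right (by positivity))
  simp only [predContrast]
  rw [average_step, average_step, smul_add, smul_neg]
  abel

/-- Asymptotic normality of the estimator. -/
theorem asymptotic_normality [IsProbabilityMeasure P]
    (hpsi : ∀ θ : Vec q, Measurable fun p : ℝ × Vec d => psi p.1 p.2 θ)
    (hqhat : Measurable qhat)
    (hlaw : ∀ i, HasLaw (D i) P μ) (hindep : iIndepFun D μ) (hN : Tendsto N atTop atTop)
    (hρ : Tendsto (fun n : ℕ => (n : ℝ) / (N n : ℝ)) atTop (𝓝 ρ))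
    (hident : Identified P (score psi) Θ θ₀)
    (hcont : ContinuousInParam P (score psi) Θ)
    (hcont' : ContinuousInParam P (predScore psi qhat) Θ)
    (hmom : MomentBounds P (score psi) Θ) (hmom' : MomentBounds P (predScore psi qhat) Θ)
    (hreg : LocallyRegular P (score psi) θ₀) (hreg' : LocallyRegular P (predScore psi qhat) θ₀)
    (hns : NonsingularMeanDeriv P (score psi) θ₀)
    {w : Fin q → ℝ} {what : ℕ → Ω → Fin q → ℝ}
    (hwhat : TendstoInMeasure μ what atTop (fun _ => w))
    {θhat : ℕ → Ω → Vec q} (hθhat_meas : ∀ n, AEMeasurable (θhat n) μ)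
    (hθhat : Tendsto (fun n => μ {s | ¬ (θhat n s ∈ Θ ∧
      estEq psi qhat n (N n) (fun i => D i s) (what n s) (θhat n s) = 0)}) atTop (𝓝 0)) :
    (asympCov P psi qhat θ₀ ρ w).PosSemidef ∧
    TendstoInDistribution (fun (n : ℕ) s => Real.sqrt n • (θhat n s - θ₀)) atTop
      id (fun _ => μ) (multivariateGaussian 0 (asympCov P psi qhat θ₀ ρ w)) := by
  have hf : MemLp (fun p => score psi p θ₀) 2 P :=
    hmom.memLp hident.mem (measurable_score hpsi θ₀)
  have hg : MemLp (fun p => predScore psi qhat p θ₀) 2 P :=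
    hmom'.memLp hident.mem (measurable_predScore hpsi hqhat θ₀)
  have hdet : (A P psi θ₀).det ≠ 0 := by
    obtain ⟨r, hr, h, hh, hQ⟩ := hreg.exists_diffQuot
      fun θ => (measurable_score hpsi θ).aemeasurable
    obtain ⟨hm, hcQ, hb⟩ := hQ r hr le_rfl
    exact det_meanJacobian_ne_zero hns (hf.integrable (by norm_num)) hr hh hm hb
      (ae_tendstoUniformly_average hlaw hindep hm hcQ hh hb).1
  set J := Matrix.toEuclideanCLM (𝕜 := ℝ) (A P psi θ₀) with hJ
  set B := Matrix.toEuclideanCLM (𝕜 := ℝ) (A P psi θ₀)⁻¹ with hB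
  have hBJ : ∀ v, B (J v) = v := by
    intro v
    rw [← mul_apply_eq_comp, ← map_mul, Matrix.nonsing_inv_mul _ hdet.isUnit, map_one]
    rfl
  have hfi := hf.integrable (by norm_num)
  have hgi := hg.integrable (by norm_num)
  -- central limit theorems for the two averages at `θ₀`
  have hclt_a := (tendstoInDistribution_two_sample_crossCov hlaw hindep hN hρ hf
    (η := fun _ => 0) MemLp.zero' (by simpa using hident.solves)).2
  have hclt_c := (tendstoInDistribution_two_sample_crossCov hlaw hindep hN hρ hg.neg hg
    (by simp only [Pi.neg_apply, integral_neg, neg_add_cancel])).2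
  simp only [Finset.sum_const_zero, smul_zero, add_zero] at hclt_a
  simp only [Pi.neg_apply, Finset.sum_neg_distrib, smul_neg] at hclt_c
  have hWg := memLp_toEuclideanCLM (-Matrix.diagonal w) hg
  have hWg' := memLp_toEuclideanCLM (Matrix.diagonal w) hg
  have hs : MemLp (fun p => score psi p θ₀ +
      Matrix.toEuclideanCLM (𝕜 := ℝ) (-Matrix.diagonal w) (predScore psi qhat p θ₀)) 2 P :=
    hf.add hWg
  obtain ⟨hpsd, hclt⟩ := tendstoInDistribution_two_sample_crossCov hlaw hindep hN hρ
    (memLp_toEuclideanCLM (-(A P psi θ₀)⁻¹) hs) (memLp_toEuclideanCLM (-(A P psi θ₀)⁻¹) hWg') (by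
      rw [ContinuousLinearMap.integral_comp_comm _ (hs.integrable (by norm_num)),
        ContinuousLinearMap.integral_comp_comm _ (hWg'.integrable (by norm_num)), ← map_add,
        integral_add hfi (hWg.integrable (by norm_num)), hident.solves, zero_add,
        ← integral_add (hWg.integrable (by norm_num)) (hWg'.integrable (by norm_num))]
      simp only [map_neg, neg_apply, neg_add_cancel, integral_zero, map_zero])
  rw [← asympCov_eq hf hg] at hpsd hclt
  refine ⟨hpsd, ?_⟩
  set a : ℕ → Ω → Vec q := fun n s => scoreAvg psi n (fun i => D i s) θ₀ with ha_def
  set c : ℕ → Ω → Vec q := fun n s => predContrast psi qhat n (N n) (fun i => D i s) θ₀ with hc_def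
  have hsm : ∀ {g : Obs d Z → Vec q} (i : ℕ), MemLp g 2 P →
      AEMeasurable (fun s => g (D i s)) μ := by
    intro g i hg
    exact AEMeasurable.comp_aemeasurable (by rw [(hlaw i).map_eq]; exact hg.1.aemeasurable)
      (hlaw i).aemeasurable
  have ha : ∀ n, AEMeasurable (a n) μ := by
    intro n
    have h1 : AEMeasurable (fun s => ∑ i ∈ Finset.range n, score psi (D i s) θ₀) μ :=
      Finset.aemeasurable_fun_sum _ fun i _ => hsm i hf
    simp only [ha_def, scoreAvg]
    fun_prop
  have hc : ∀ n, AEMeasurable (c n) μ := by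
    intro n
    have h1 : AEMeasurable (fun s => ∑ i ∈ Finset.range n, predScore psi qhat (D i s) θ₀) μ :=
      Finset.aemeasurable_fun_sum _ fun i _ => hsm i hg
    have h2 : AEMeasurable (fun s => ∑ i ∈ Finset.Ico n (n + N n),
        predScore psi qhat (D i s) θ₀) μ :=
      Finset.aemeasurable_fun_sum _ fun i _ => hsm i hg
    simp only [hc_def, predContrast]
    fun_prop
  -- Relative linearization error. The term `(n + 1)⁻¹` keeps the denominator positive and stays
  -- bounded after multiplication by `√n`.
  set ε : ℕ → Ω → ℝ := fun n s => ‖J (θhat n s - θ₀) + (a n s + diagMul w (c n s))‖ /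
    (‖a n s‖ + ‖c n s‖ + ((n : ℝ) + 1)⁻¹) with hε
  obtain ⟨hεm, hε0⟩ := tendstoInMeasure_linearization_error hpsi hqhat hlaw hindep hN hρ hident hcont
    hcont' hmom hmom' hreg hreg' hdet hwhat hθhat_meas hθhat ha hc hε
  have hεd : ∀ n s, ‖J (θhat n s - θ₀) + (a n s + diagMul w (c n s))‖ =
      ε n s * (‖a n s‖ + ‖c n s‖ + ((n : ℝ) + 1)⁻¹) := fun n s => by
    rw [hε]
    field_simp
  have hεnn : ∀ n s, 0 ≤ ε n s := fun n s => by rw [hε]; positivity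
  -- Both scaled averages converge in distribution, so their products with the vanishing relative
  -- error vanish in probability.
  have hbound : TendstoInMeasure μ (fun n s => ‖B‖ * ε n s * ‖√n • a n s‖ +
      ‖B‖ * ε n s * ‖√n • c n s‖ + ‖B‖ * ε n s) atTop fun _ => 0 := by
    have hBε : TendstoInMeasure μ (fun n s => ‖B‖ * ε n s) atTop fun _ => 0 := by
      have hcst : TendstoInDistribution (fun (_ : ℕ) (_ : Ω) => ‖B‖) atTop (fun _ => ‖B‖)
          (fun _ => μ) μ := tendstoInDistribution_const aemeasurable_const
      have := tendstoInMeasure_mul_norm hεm hε0 hcst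
      simpa only [norm_norm, mul_comm] using this
    have hBεm : ∀ n, AEMeasurable (fun s => ‖B‖ * ε n s) μ := fun n => (hεm n).const_mul _
    exact tendstoInMeasure_add_zero (tendstoInMeasure_add_zero
      (tendstoInMeasure_mul_norm hBεm hBε hclt_a) (tendstoInMeasure_mul_norm hBεm hBε hclt_c)) hBε
  refine tendstoInDistribution_of_tendstoInMeasure_sub _ _ hclt
    (tendstoInMeasure_zero_of_norm_le hbound fun n s => ?_) fun n => by
      have := hθhat_meas n
      fun_prop
  have hX : √n • ((n : ℝ)⁻¹ • ∑ i ∈ Finset.range n,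
      Matrix.toEuclideanCLM (𝕜 := ℝ) (-(A P psi θ₀)⁻¹) (score psi (D i s) θ₀ +
        Matrix.toEuclideanCLM (𝕜 := ℝ) (-Matrix.diagonal w) (predScore psi qhat (D i s) θ₀)) +
      (N n : ℝ)⁻¹ • ∑ i ∈ Finset.Ico n (n + N n), Matrix.toEuclideanCLM (𝕜 := ℝ) (-(A P psi θ₀)⁻¹)
        (Matrix.toEuclideanCLM (𝕜 := ℝ) (Matrix.diagonal w) (predScore psi qhat (D i s) θ₀))) =
      -(√n • B (a n s + diagMul w (c n s))) := by
    rw [diagMul_eq_toEuclideanCLM, ← map_sum, ← map_sum, ← map_smul, ← map_smul, ← map_add,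
      Finset.sum_add_distrib, ← map_sum, ← map_sum]
    simp only [map_neg, neg_apply, ← smul_neg, hB]
    congr 3
    simp only [ha_def, hc_def, scoreAvg, predContrast, map_add, map_neg, map_smul, smul_add,
      smul_neg]
    abel
  have hdiff : ((fun (n : ℕ) s => √n • (θhat n s - θ₀)) n - fun s =>
      √n • ((n : ℝ)⁻¹ • ∑ i ∈ Finset.range n,
      Matrix.toEuclideanCLM (𝕜 := ℝ) (-(A P psi θ₀)⁻¹) (score psi (D i s) θ₀ +
        Matrix.toEuclideanCLM (𝕜 := ℝ) (-Matrix.diagonal w) (predScore psi qhat (D i s) θ₀)) +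
      (N n : ℝ)⁻¹ • ∑ i ∈ Finset.Ico n (n + N n), Matrix.toEuclideanCLM (𝕜 := ℝ) (-(A P psi θ₀)⁻¹)
        (Matrix.toEuclideanCLM (𝕜 := ℝ) (Matrix.diagonal w) (predScore psi qhat (D i s) θ₀)))) s =
      √n • B (J (θhat n s - θ₀) + (a n s + diagMul w (c n s))) := by
    simp only [Pi.sub_apply]
    rw [hX, map_add B (J _) _, hBJ, smul_add, sub_neg_eq_add]
  refine (congrArg norm hdiff).le.trans ?_
  have hsq : √(n : ℝ) * ((n : ℝ) + 1)⁻¹ ≤ 1 := by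
    rw [← div_eq_mul_inv, div_le_one (by positivity)]
    nlinarith [Real.sq_sqrt (Nat.cast_nonneg (α := ℝ) n), sq_nonneg (√(n : ℝ) - 1),
      Real.sqrt_nonneg (n : ℝ)]
  calc ‖√n • B (J (θhat n s - θ₀) + (a n s + diagMul w (c n s)))‖
      ≤ √n * (‖B‖ * (ε n s * (‖a n s‖ + ‖c n s‖ + ((n : ℝ) + 1)⁻¹))) := by
        rw [norm_smul, Real.norm_of_nonneg (Real.sqrt_nonneg _), ← hεd]
        gcongr
        exact B.le_opNorm _
    _ = ‖B‖ * ε n s * ‖√n • a n s‖ + ‖B‖ * ε n s * ‖√n • c n s‖ +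
        ‖B‖ * ε n s * (√(n : ℝ) * ((n : ℝ) + 1)⁻¹) := by
        rw [norm_smul, norm_smul, Real.norm_of_nonneg (Real.sqrt_nonneg _)]
        ring
    _ ≤ _ := by
        have := mul_le_of_le_one_right (mul_nonneg (norm_nonneg B) (hεnn n s)) hsq
        linarith

end Asymptotics

/-! ### Normal quantiles and coverage of the Wald interval -/

section Coverage

/-- Right continuity of the distribution function shows that the infimum defining the quantile still
satisfies the inequality. This direction suffices for a lower bound on coverage. -/
lemma le_cdf_normalQuantile {p : ℝ} (hp : p ∈ Set.Ioo (0 : ℝ) 1) :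
    p ≤ cdf (gaussianReal 0 1) (normalQuantile p) := by
  set F := cdf (gaussianReal 0 1)
  set A : Set ℝ := {x : ℝ | p ≤ F x}
  have hne : A.Nonempty := by
    obtain ⟨x, hx⟩ := ((tendsto_cdf_atTop (gaussianReal 0 1)).eventually_const_le hp.2).exists
    exact ⟨x, hx⟩
  have hright := F.right_continuous (normalQuantile p)
  have htend : Tendsto F (𝓝[>] normalQuantile p) (𝓝 (F (normalQuantile p))) :=
    hright.tendsto.mono_left (nhdsWithin_mono _ Set.Ioi_subset_Ici_self)
  refine ge_of_tendsto htend ?_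
  filter_upwards [self_mem_nhdsWithin] with x hx
  obtain ⟨y, hy, hyx⟩ := exists_lt_of_csInf_lt hne (show sInf A < x from hx)
  exact le_trans hy (F.mono hyx.le)

lemma one_sub_le_gaussianReal_abs_lt {α : ℝ} (hα : α ∈ Set.Ioo (0 : ℝ) 1) {v : ℝ} (hv : 0 < v) :
    1 - α ≤ (gaussianReal 0 v.toNNReal).real {x | |x| - normalQuantile (1 - α / 2) * √v < 0} := by
  set z := normalQuantile (1 - α / 2)
  have hz := le_cdf_normalQuantile (p := 1 - α / 2) ⟨by linarith [hα.2], by linarith [hα.1]⟩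
  rw [cdf_eq_real] at hz
  have hsq : 0 < √v := Real.sqrt_pos.2 hv
  have hmap : gaussianReal 0 v.toNNReal = (gaussianReal 0 1).map (√v * ·) := by
    rw [gaussianReal_map_const_mul, mul_zero, mul_one]
    congr 1
    ext
    simp [Real.sq_sqrt hv.le, hv.le]
  have hms : MeasurableSet {x : ℝ | |x| - z * √v < 0} :=
    measurableSet_lt (by fun_prop) measurable_const
  rw [hmap, map_measureReal_apply (by fun_prop) hms]
  -- As a set difference, the event has mass at least the difference of the two masses, whatever the
  -- sign of `z`; symmetry and absence of atoms bound the lower tail by `α / 2`.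
  have hset : ((√v * ·) ⁻¹' {x : ℝ | |x| - z * √v < 0}) = Set.Iio z \ Set.Iic (-z) := by
    ext y
    simp only [Set.mem_preimage, Set.mem_ofPred_eq, Set.mem_sdiff, Set.mem_Iio, Set.mem_Iic, not_le,
      abs_mul, abs_of_pos hsq]
    rw [and_comm, ← abs_lt]
    constructor <;> intro h
    · nlinarith
    · nlinarith
  rw [hset]
  have : NullSingletonClass (gaussianReal 0 1) := nullSingletonClass_gaussianReal one_ne_zero
  have h1 : (gaussianReal 0 1).real (Set.Iio z) = (gaussianReal 0 1).real (Set.Iic z) :=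
    measureReal_congr Iio_ae_eq_Iic
  have h2 : (gaussianReal 0 1).real (Set.Iic (-z)) ≤ α / 2 := by
    have hneg : (gaussianReal 0 1).map (fun x : ℝ => -x) = gaussianReal 0 1 := by
      rw [gaussianReal_map_neg, neg_zero]
    rw [← hneg, map_measureReal_apply measurable_neg measurableSet_Iic]
    have : (fun x : ℝ => -x) ⁻¹' Set.Iic (-z) = (Set.Iio z)ᶜ := by
      ext x; simp
    rw [this, probReal_compl_eq_one_sub measurableSet_Iio, h1]
    linarith
  have h3 := le_measureReal_sdiff (μ := gaussianReal 0 1) (s₁ := Set.Iio z) (s₂ := Set.Iic (-z))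
  linarith

lemma mem_waldInterval_iff {α : ℝ} {n : ℕ} (hn : 0 < n) (θ est var : ℝ) :
    θ ∈ waldInterval α n est var ↔
      |√n * (est - θ)| - normalQuantile (1 - α / 2) * √var < 0 := by
  have hn' : (0 : ℝ) < n := by exact_mod_cast hn
  have hs : 0 < √(n : ℝ) := Real.sqrt_pos.2 hn'
  rw [waldInterval, Real.sqrt_div' _ hn'.le, ← mul_div_assoc, sub_neg, abs_mul, abs_of_pos hs,
    ← lt_div_iff₀' hs, abs_lt, Set.mem_Ioo]
  constructor <;> rintro ⟨h1, h2⟩ <;> constructor <;> linarith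

/-- Asymptotic coverage of Wald intervals for an asymptotically normal coordinate. -/
lemma exists_tendsto_coverage {q : ℕ} {Ω : Type*} [MeasurableSpace Ω] {μ : Measure Ω}
    [IsProbabilityMeasure μ] {θhat : ℕ → Ω → Vec q} {θ₀ : Vec q}
    {Sig : Matrix (Fin q) (Fin q) ℝ} (hSig : Sig.PosSemidef)
    (hclt : TendstoInDistribution (fun (n : ℕ) s => √n • (θhat n s - θ₀)) atTop
      id (fun _ => μ) (multivariateGaussian 0 Sig)) {j : Fin q} (hj : 0 < Sig j j)
    {V : ℕ → Ω → ℝ} (hVm : ∀ n, AEMeasurable (V n) μ)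
    (hV : TendstoInMeasure μ V atTop fun _ => Sig j j) {α : ℝ} (hα : α ∈ Set.Ioo (0 : ℝ) 1) :
    ∃ c : ℝ, 1 - α ≤ c ∧ Tendsto (fun n => μ.real {s | θ₀ j ∈
      waldInterval α n (θhat n s j) (V n s)}) atTop (𝓝 c) := by
  set z := normalQuantile (1 - α / 2)
  have h := hclt.continuous_comp_prodMk_of_tendstoInMeasure_const
    (g := fun p : Vec q × ℝ => |p.1 j| - z * √p.2) (by fun_prop) hV hVm
  have hlim : (multivariateGaussian 0 Sig).map (fun ω => |ω j| - z * √(Sig j j)) =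
      (gaussianReal 0 (Sig j j).toNNReal).map (fun x => |x| - z * √(Sig j j)) := by
    have hmp := measurePreserving_eval_multivariateGaussian (μ := (0 : Vec q)) hSig (i := j)
    have e := hmp.map_eq
    rw [PiLp.zero_apply] at e
    rw [← e, Measure.map_map (by fun_prop) (by fun_prop)]
    rfl
  have hvne : (Sig j j).toNNReal ≠ 0 := (Real.toNNReal_pos.2 hj).ne'
  have : NullSingletonClass (gaussianReal 0 (Sig j j).toNNReal) := nullSingletonClass_gaussianReal hvne
  have hmf : Measurable fun x : ℝ => |x| - z * √(Sig j j) := by fun_prop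
  refine ⟨_, one_sub_le_gaussianReal_abs_lt hα hj, ?_⟩
  -- Coverage is the event that the statistic is negative. Its boundary value 0 is attained at no
  -- more than two values of the coordinate, null since `Sig j j > 0` excludes atoms.
  have hfr : (multivariateGaussian 0 Sig).map (fun ω => |ω j| - z * √(Sig j j))
      (frontier (Set.Iio 0)) = 0 := by
    rw [hlim, frontier_Iio, Measure.map_apply hmf (measurableSet_singleton _)]
    refine measure_mono_null (t := {z * √(Sig j j), -(z * √(Sig j j))}) (fun x hx => ?_) ?_
    · simp only [Set.mem_preimage, Set.mem_singleton_iff, sub_eq_zero] at hx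
      exact eq_or_eq_neg_of_abs_eq hx
    · exact (Set.toFinite _).measure_zero _
  have key := ProbabilityMeasure.tendsto_measure_of_null_frontier_of_tendsto' h.tendsto hfr
  simp only [ProbabilityMeasure.coe_mk, id] at key
  have key' := (ENNReal.tendsto_toReal (measure_ne_top _ _)).comp key
  rw [hlim, Measure.map_apply hmf measurableSet_Iio] at key'
  refine key'.congr' ?_
  filter_upwards [eventually_gt_atTop 0] with n hn
  simp only [Function.comp_apply]
  rw [Measure.map_apply_of_aemeasurable (h.forall_aemeasurable n) measurableSet_Iio, measureReal_def]
  congr 2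
  ext s
  simp only [Set.mem_preimage, Set.mem_Iio, Set.mem_ofPred_eq]
  rw [mem_waldInterval_iff hn]
  simp [z]

end Coverage

end PSPA

end

theorem corollary4 {d q : ℕ} {Z : Type*} [MeasurableSpace Z]
    -- estimating function, prediction algorithm, parameter space and true parameter
    (psi : ℝ → PSPA.Vec d → PSPA.Vec q → PSPA.Vec q)
    (hpsi : ∀ θ : PSPA.Vec q, Measurable fun p : ℝ × PSPA.Vec d => psi p.1 p.2 θ)
    (qhat : Z → PSPA.Vec d) (hqhat : Measurable qhat)
    (Θ : Set (PSPA.Vec q)) (θ₀ : PSPA.Vec q)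
    -- the population and an i.i.d. sample `D 0, D 1, …` from it
    (P : Measure (PSPA.Obs d Z)) [IsProbabilityMeasure P]
    {Ω : Type*} [MeasurableSpace Ω] (μ : Measure Ω) [IsProbabilityMeasure μ]
    (D : ℕ → Ω → PSPA.Obs d Z)
    (hlaw : ∀ i, HasLaw (D i) P μ) (hindep : iIndepFun D μ)
    -- sample sizes: `n` labeled and `N n` unlabeled data
    (N : ℕ → ℕ) (hN : Tendsto N atTop atTop)
    (ρ : ℝ) (hρ : Tendsto (fun n : ℕ => (n : ℝ) / (N n : ℝ)) atTop (𝓝 ρ))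
    -- identification, continuity and moment conditions
    (hident : PSPA.Identified P (PSPA.score psi) Θ θ₀)
    (hcont : PSPA.ContinuousInParam P (PSPA.score psi) Θ)
    (hcont' : PSPA.ContinuousInParam P (PSPA.predScore psi qhat) Θ)
    (hmom : PSPA.MomentBounds P (PSPA.score psi) Θ)
    (hmom' : PSPA.MomentBounds P (PSPA.predScore psi qhat) Θ)
    -- consistent estimated weights
    (w : Fin q → ℝ) (what : ℕ → Ω → Fin q → ℝ) (hwhat_meas : ∀ n, AEMeasurable (what n) μ)
    (hwhat : TendstoInMeasure μ what atTop (fun _ => w))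
    -- the estimator, a solution in `Θ` of the estimating equation with probability tending to one
    (θhat : ℕ → Ω → PSPA.Vec q) (hθhat_meas : ∀ n, AEMeasurable (θhat n) μ)
    (hθhat : Tendsto (fun n => μ {s | ¬ (θhat n s ∈ Θ ∧
      PSPA.estEq psi qhat n (N n) (fun i => D i s) (what n s) (θhat n s) = 0)}) atTop (𝓝 0)) :
    -- consistency
    TendstoInMeasure μ θhat atTop (fun _ => θ₀) ∧
    -- under the additional local conditions:
    (PSPA.LocallyRegular P (PSPA.score psi) θ₀ →
      PSPA.LocallyRegular P (PSPA.predScore psi qhat) θ₀ →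
      PSPA.NonsingularMeanDeriv P (PSPA.score psi) θ₀ →
      -- asymptotic normality
      (PSPA.asympCov P psi qhat θ₀ ρ w).PosSemidef ∧
      TendstoInDistribution (fun (n : ℕ) s => Real.sqrt n • (θhat n s - θ₀)) atTop
        id (fun _ => μ) (multivariateGaussian 0 (PSPA.asympCov P psi qhat θ₀ ρ w)) ∧
      -- asymptotic coverage of the Wald intervals
      ∀ (Sigmahat : ℕ → Ω → Matrix (Fin q) (Fin q) ℝ),
        (∀ n i j, AEMeasurable (fun s => Sigmahat n s i j) μ) →
        (∀ i j, TendstoInMeasure μ (fun n s => Sigmahat n s i j) atTop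
          (fun _ => PSPA.asympCov P psi qhat θ₀ ρ w i j)) →
        ∀ α ∈ Set.Ioo (0 : ℝ) 1, ∀ j : Fin q, 0 < PSPA.asympCov P psi qhat θ₀ ρ w j j →
          ∃ c : ℝ, 1 - α ≤ c ∧
            Tendsto (fun n => μ.real {s | θ₀ j ∈
              PSPA.waldInterval α n (θhat n s j) (Sigmahat n s j j)}) atTop (𝓝 c)) := by
  refine ⟨?_, fun hreg hreg' hns => ?_⟩
  · exact PSPA.tendstoInMeasure_of_subseq (fun n => (hθhat_meas n).aestronglyMeasurable) hwhat hθhat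
      (PSPA.ae_tendsto_estimator hpsi hqhat hlaw hindep hN hρ hident hcont hcont' hmom hmom' w what
        θhat)
  · obtain ⟨hpsd, hclt⟩ := PSPA.asymptotic_normality hpsi hqhat hlaw hindep hN hρ hident hcont hcont'
      hmom hmom' hreg hreg' hns hwhat hθhat_meas hθhat
    exact ⟨hpsd, hclt, fun Sigmahat hm hSigmahat α hα j hj =>
      PSPA.exists_tendsto_coverage hpsd hclt hj (fun n => hm n j j) (hSigmahat j j) hα⟩
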